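/- Let $\ell$ be a prime. Let $K$ be either a finite field or an $\ell$-adic field (a finite extension of $\mathbb{Q}_\ell$), and let $L/K$ be a (finite or infinite) Galois extension with group $\Gamma=\mathrm{Gal}(L/K)$. Give $L$ the discrete topology if $K$ is finite, and the topology of the unique extension of the $\ell$-adic absolute value otherwise. Let $G$ be a compact topological group and let $\rho\colon G\to\mathcal{H}(L)$ be a continuous representation, where either $\mathcal{H}=\mathrm{GL}_n$, or $n$ is even and $\mathcal{H}=\mathrm{GSp}_n$ (the matrices preserving the standard symplectic form up to a scalar multiplier). Write $P\mathcal{H}(F)$ for $\mathcal{H}(F)$ modulo scalar matrices, that is, $\mathrm{PGL}_n(F)$ or $\mathrm{PGSp}_n(F)$ respectively, and $\rho^{\mathrm{proj}}\colon G\to P\mathcal{H}(L)$ for the composition of $\rho$ with the natural projection. An inner twist of $[\rho]$ is a pair $(\gamma,\epsilon)$ consisting of $\gamma\in\Gamma$ and a continuous character $\epsilon\colon G\to L^\times$ such that ${}^\gamma\rho=\gamma\circ\rho$ and $\rho\otimes\epsilon$ are conjugate by an element of $\mathcal{H}(L)$. Let $\Gamma_{[\rho]}\subseteq\Gamma$ be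 the set (in fact a subgroup) of all $\gamma$ that occur in some inner twist $(\gamma,\epsilon)$ of $[\rho]$, let $K_{[\rho]}=L^{\Gamma_{[\rho]}}$ be its fixed field, and let $I_{[\rho]}\subseteq G$ be the intersection of the kernels of all characters $\epsilon$ that occur in some inner twist $(\gamma,\epsilon)$ of $[\rho]$. Assume that the restriction of $\rho$ to $I_{[\rho]}$, viewed as a linear representation, is absolutely irreducible if $K$ is finite, and residually absolutely irreducible if $K$ is $\ell$-adic (that is, it is conjugate in $\mathrm{GL}_n(L)$ to a representation over the valuation ring of $L$ whose reduction modulo the maximal ideal is absolutely irreducible). Then $\rho^{\mathrm{proj}}$ is conjugate, by the class of a matrix in $\mathcal{H}(L)$, to a continuous projective representation that factors through $P\mathcal{H}(K_{[\rho]})\hookrightarrow P\mathcal{H}(L)$. Moreover, $K_{[\rho]}$ is the smallest field $F$ with $K\subseteq F\subseteq L$ with this property: whenever $\rho^{\mathrm{proj}}$ is conjugate, by the class of a matrix in $\mathcal{H}(L)$, to a continuous projective representation that factors through $P\mathcal{H}(F)$, one has $K_{[\rho]}\subseteq F$. -/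

import Mathlib

namespace InnerTwist

universe u v w

open Matrix

/-- A family of matrix groups `F ↦ 𝒢(F) ≤ GL_ι(F)`, one for each field, compatible with field
homomorphisms. Only the two instances `linear` and `symplectic` below are used. -/
structure MatrixGroup (ι : Type) [Fintype ι] [DecidableEq ι] where
  /-- The group of `F`-points. -/
  pts : ∀ (F : Type u) [Field F], Subgroup (GL ι F)
  map_mem : ∀ {F E : Type u} [Field F] [Field E] (f : F →+* E) {A : GL ι F},
    A ∈ pts F → GeneralLinearGroup.map f A ∈ pts E

/-- The general linear group `GL_n`. -/
def linear (n : ℕ) : MatrixGroup.{u} (Fin n) where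
  pts _ _ := ⊤
  map_mem _ _ _ := Subgroup.mem_top _

/-- The general symplectic group `GSp_{2m}(F)`: the invertible `2m × 2m` matrices `A` with
`Aᵀ J A = c J` for some `c ∈ Fˣ` (the multiplier of `A`), where `J` is the standard
symplectic form. -/
def gsp (m : ℕ) (F : Type u) [Field F] : Subgroup (GL (Fin m ⊕ Fin m) F) where
  carrier := {A | ∃ c : Fˣ, A.valᵀ * J (Fin m) F * A.val = (c : F) • J (Fin m) F}
  one_mem' := ⟨1, by simp⟩
  mul_mem' := by
    rintro A B ⟨c, hc⟩ ⟨d, hd⟩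
    refine ⟨c * d, ?_⟩
    calc (A * B).valᵀ * J (Fin m) F * (A * B).val
        = B.valᵀ * (A.valᵀ * J (Fin m) F * A.val) * B.val := by
          simp [Matrix.mul_assoc]
      _ = ((c * d : Fˣ) : F) • J (Fin m) F := by
          rw [hc]; simp [hd, smul_smul]
  inv_mem' := by
    rintro A ⟨c, hc⟩
    refine ⟨c⁻¹, ?_⟩
    have h1 : A.val * (A⁻¹).val = 1 := by
      rw [← Units.val_mul, mul_inv_cancel, Units.val_one]
    have h2 : (A⁻¹).valᵀ * A.valᵀ = 1 := by
      rw [← Matrix.transpose_mul, h1, Matrix.transpose_one]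
    have h3 : J (Fin m) F
        = (c : F) • ((A⁻¹).valᵀ * J (Fin m) F * (A⁻¹).val) := by
      calc J (Fin m) F
          = ((A⁻¹).valᵀ * A.valᵀ) * J (Fin m) F * (A.val * (A⁻¹).val) := by
            rw [h1, h2]; simp
        _ = (A⁻¹).valᵀ * (A.valᵀ * J (Fin m) F * A.val) * (A⁻¹).val := by
            simp only [Matrix.mul_assoc]
        _ = _ := by rw [hc]; simp
    conv_rhs => rw [h3]
    rw [smul_smul, Units.inv_mul, one_smul]

/-- The general symplectic group as a family of matrix groups. -/
def symplectic (m : ℕ) : MatrixGroup.{u} (Fin m ⊕ Fin m) where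
  pts F _ := gsp m F
  map_mem := by
    rintro F E _ _ f A ⟨c, hc⟩
    refine ⟨Units.map f.toMonoidHom c, ?_⟩
    have hJ : J (Fin m) E = (J (Fin m) F).map f := by
      ext i j
      rcases i with i | i <;> rcases j with j | j <;>
        simp [J, Matrix.one_apply, apply_ite f]
    have h := congrArg (fun B : Matrix (Fin m ⊕ Fin m) (Fin m ⊕ Fin m) F => B.map f) hc
    simp only [Matrix.map_mul] at h
    rw [hJ]
    refine Eq.trans h ?_
    ext i j
    simpa using (congrFun (congrFun hJ i) j).symm

section

variable {ι : Type} [Fintype ι] [DecidableEq ι]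

/-- The group of scalar matrices `a • 1` with `a ∈ Fˣ`. -/
def scalars (ι : Type) [Fintype ι] [DecidableEq ι] (F : Type u) [Field F] :
    Subgroup (GL ι F) :=
  (GeneralLinearGroup.scalar ι : Fˣ →* GL ι F).range

theorem scalars_eq_center (F : Type u) [Field F] :
    scalars ι F = Subgroup.center (GL ι F) :=
  GeneralLinearGroup.center_eq_range_scalar.symm

instance (F : Type u) [Field F] : (scalars ι F).Normal := by
  rw [scalars_eq_center]; infer_instance

/-- The projective group `𝒢(F) / scalars`; this is `PGL_n(F)` for `linear n` and
`PGSp_{2m}(F)` for `symplectic m`. -/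
abbrev Proj (𝒢 : MatrixGroup.{u} ι) (F : Type u) [Field F] : Type u :=
  𝒢.pts F ⧸ (scalars ι F).subgroupOf (𝒢.pts F)

/-- The homomorphism `𝒢(F) → 𝒢(E)` given by a field homomorphism `F → E`. -/
def MatrixGroup.map (𝒢 : MatrixGroup.{u} ι) {F E : Type u} [Field F] [Field E]
    (f : F →+* E) : 𝒢.pts F →* 𝒢.pts E :=
  ((GeneralLinearGroup.map f).comp (𝒢.pts F).subtype).codRestrict (𝒢.pts E)
    fun A => 𝒢.map_mem f A.2

/-- The natural homomorphism `𝒢(F)/scalars → 𝒢(E)/scalars` given by `F → E`. -/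
def Proj.map (𝒢 : MatrixGroup.{u} ι) {F E : Type u} [Field F] [Field E]
    (f : F →+* E) : Proj 𝒢 F →* Proj 𝒢 E :=
  QuotientGroup.map _ _ (𝒢.map f) <| by
    rintro A ⟨a, ha⟩
    refine ⟨Units.map f.toMonoidHom a, ?_⟩
    have h := congrArg (GeneralLinearGroup.map f) ha
    rw [GeneralLinearGroup.map_scalar] at h
    exact h

/-! ### Absolute irreducibility -/

/-- A matrix representation over a field `k` is absolutely irreducible if the representation
on `k̄^ι` is irreducible, where `k̄` is an algebraic closure of `k`. -/
def IsAbsolutelyIrreducible {H : Type w} [Group H] {k : Type u} [Field k]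
    (σ : H →* GL ι k) : Prop :=
  Representation.IsIrreducible (k := AlgebraicClosure k) (G := H)
    (V := ι → AlgebraicClosure k)
    ((Matrix.toLinAlgEquiv' :
        Matrix ι ι (AlgebraicClosure k) ≃ₐ[AlgebraicClosure k] _).toMonoidHom.comp
      ((Units.coeHom _).comp
        ((GeneralLinearGroup.map (algebraMap k (AlgebraicClosure k))).comp σ)))

/-- `σ : H → GL_ι(L)` is residually absolutely irreducible with respect to the valuation ring
`𝒪` of `L`: some conjugate of `σ` by a matrix in `GL_ι(L)` has values in `GL_ι(𝒪)`, and its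
reduction modulo the maximal ideal of `𝒪` is absolutely irreducible. -/
def IsResiduallyAbsolutelyIrreducible {H : Type w} [Group H] {L : Type u} [Field L]
    (𝒪 : ValuationSubring L) (σ : H →* GL ι L) : Prop :=
  ∃ (M : GL ι L) (σ₀ : H →* GL ι 𝒪),
    (∀ h, GeneralLinearGroup.map 𝒪.subtype (σ₀ h) = M * σ h * M⁻¹) ∧
    IsAbsolutelyIrreducible
      ((GeneralLinearGroup.map (IsLocalRing.residue 𝒪)).comp σ₀)

/-! ### Inner twists -/

variable {G : Type w} [Group G] [TopologicalSpace G]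
  {L : Type u} [Field L] [TopologicalSpace L]
  (𝒢 : MatrixGroup.{u} ι) (ρ : G →ₜ* 𝒢.pts L)

/-- The pair `(γ, ε)`, with `γ ∈ Gal(L/K)` and `ε : G → Lˣ` a continuous character, is an inner
twist of `[ρ]`: the representations `^γ ρ` and `ρ ⊗ ε` are conjugate by an element of `𝒢(L)`. -/
def IsInnerTwist (K : Type v) [Field K] [Algebra K L]
    (γ : L ≃ₐ[K] L) (ε : G →ₜ* Lˣ) : Prop :=
  ∃ M : 𝒢.pts L, ∀ g : G,
    GeneralLinearGroup.map (γ : L →+* L) (ρ g : GL ι L) =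
      (M : GL ι L) * (GeneralLinearGroup.scalar ι (ε g) * (ρ g : GL ι L)) * (M : GL ι L)⁻¹

/-- The set `Γ_[ρ]` of all `γ ∈ Gal(L/K)` that occur in an inner twist of `[ρ]`. -/
def twistGalois (K : Type v) [Field K] [Algebra K L] : Set (L ≃ₐ[K] L) :=
  {γ | ∃ ε : G →ₜ* Lˣ, IsInnerTwist 𝒢 ρ K γ ε}

/-- The field `K_[ρ] = L^{Γ_[ρ]}`. -/
def twistField (K : Type v) [Field K] [Algebra K L] : IntermediateField K L where
  carrier := {x | ∀ γ ∈ twistGalois 𝒢 ρ K, γ x = x}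
  mul_mem' hx hy γ hγ := by rw [map_mul, hx γ hγ, hy γ hγ]
  add_mem' hx hy γ hγ := by rw [map_add, hx γ hγ, hy γ hγ]
  algebraMap_mem' r γ _ := γ.commutes r
  inv_mem' x hx γ hγ := by rw [map_inv₀, hx γ hγ]

/-- The subgroup `I_[ρ]`: the intersection of the kernels of all characters `ε` that occur in
an inner twist of `[ρ]`. -/
def twistKernel (K : Type v) [Field K] [Algebra K L] : Subgroup G :=
  ⨅ (ε : G →ₜ* Lˣ) (_ : ∃ γ : L ≃ₐ[K] L, IsInnerTwist 𝒢 ρ K γ ε), ε.toMonoidHom.ker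

/-- The restriction of `ρ` to `I_[ρ]`, as a linear representation. -/
def restrictTwistKernel (K : Type v) [Field K] [Algebra K L] :
    twistKernel 𝒢 ρ K →* GL ι L :=
  ((𝒢.pts L).subtype.comp ρ.toMonoidHom).comp (twistKernel 𝒢 ρ K).subtype

/-! ### Projective representations -/

/-- `ρ^proj`: the composition of `ρ` with `𝒢(L) → 𝒢(L)/scalars`. -/
def projRep : G →ₜ* Proj 𝒢 L where
  toMonoidHom := (QuotientGroup.mk' _).comp ρ.toMonoidHom
  continuous_toFun := continuous_quotient_mk'.comp ρ.continuous_toFun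

/-- Two projective representations are equivalent if they are conjugate by the class modulo
scalars of a matrix in `𝒢(L)`. -/
def ProjEquivalent (r₁ r₂ : G →ₜ* Proj 𝒢 L) : Prop :=
  ∃ M : 𝒢.pts L, ∀ g, r₂ g = (M : Proj 𝒢 L) * r₁ g * (M : Proj 𝒢 L)⁻¹

/-- A projective representation factors through `𝒢(F)/scalars` (for a subfield `F` of `L` with
the subspace topology), as a continuous homomorphism. -/
def FactorsThrough {K : Type v} [Field K] [Algebra K L] (F : IntermediateField K L)
    (r : G →ₜ* Proj 𝒢 L) : Prop :=
  ∃ r' : G →ₜ* Proj 𝒢 F, ∀ g, r g = Proj.map 𝒢 (algebraMap F L) (r' g)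

/-- The equivalence class of `ρ^proj` has a member that factors through `𝒢(F)/scalars`. -/
def ProjDefinedOver {K : Type v} [Field K] [Algebra K L] (F : IntermediateField K L) : Prop :=
  ∃ r : G →ₜ* Proj 𝒢 L, ProjEquivalent 𝒢 (projRep 𝒢 ρ) r ∧ FactorsThrough 𝒢 F r

end

end InnerTwist

/-!
Write `E = K_[ρ]`, `I = I_[ρ]` and `σ = ρ|_I`. The easy half is minimality: if `τ = N ρ N⁻¹` is,
up to scalars `c(g)`, defined over `F`, then every `γ ∈ Gal(L/F)` satisfies `^γ τ = (γ(c)/c) τ`,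
and `γ(c)/c` is a continuous character. So `Gal(L/F) ⊆ Γ_[ρ]`, and `E ⊆ L^{Gal(L/F)} = F`
(`twistField_le_of_projDefinedOver`).

For existence, note that for `γ ∈ Γ_[ρ]` there is `M ∈ 𝒢(L)` with `^γ σ = M σ M⁻¹`, because the
character of the twist is trivial on `I`. The point is to conjugate `σ` itself into `GL_ι(E)`. The
obstruction to this lies in a Brauer group, and it is removed by a matrix `v wᵀ` of rank one with
`γ(v wᵀ) = M v wᵀ M⁻¹` for all these `γ`. Then the coefficient `h ↦ w · σ(h) v = tr(v wᵀ σ(h))` is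
`E`-valued. As the matrices `σ(h)` span the matrix algebra (`IsAbsolutelyIrreducible.span_eq_top`,
a theorem of Burnside), bases of the form `σ(hᵢ) v` and `w σ(h'ⱼ)` exist, and in them `σ` has
entries in `E` (`exists_conj_mem_of_coeff_mem`).

Over an algebraic extension of a finite field, the rank-one matrix is found in the ring generated
by `σ(I)`: finitely many `σ(h)` that span the matrix algebra generate a finite ring, and the
corner of a minimal idempotent in it is a finite domain, hence commutative by Wedderburn's little
theorem, so that the idempotent has rank one (`exists_vecMulVec_mem_closure`). In the `ℓ`-adic
case this applies to the reduction of an integral model `σ₀`. A lift `e` of the idempotent to the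
ring generated by `σ₀(I)` has a unique eigenvalue `α ≡ 1`, because the valuation ring of `L` is
henselian (`henselianLocalRing_of_isAlgebraic`). By uniqueness `α` is fixed by `Γ_[ρ]`, and the
quotient of the characteristic polynomial of `e` by `X - α`, evaluated at `e`, has rank one
(`exists_vecMulVec_of_residue`).

Once `A σ A⁻¹` has entries in `E`, Schur's lemma gives `γ(A) = s A M⁻¹` with a scalar `s`. Hence
`γ` multiplies `A ρ(g) A⁻¹` by a scalar for every `g ∈ G`, so the ratios of its entries lie in `E`
(`projDefinedOver_twistField`). For the symplectic group `A` must be corrected to lie in `GSp(L)`: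
the form transported by `A` is multiplied by a scalar under each `γ`, so a multiple of it is
defined over `E`, where it has a symplectic basis (`hasDescent_symplectic`).
-/

namespace InnerTwist

universe u v w

open Matrix

/-! ### Spanning sets of matrices and the trace form -/

section Span

variable {ι : Type*} [Fintype ι] [DecidableEq ι] {k : Type*} [Field k]

/-- The trace form is nondegenerate, so a set of matrices spans exactly if its orthogonal
complement for this form vanishes. This criterion is insensitive to extension of the base field.
-/
theorem span_eq_top_iff_trace {S : Set (Matrix ι ι k)} :
    Submodule.span k S = ⊤ ↔
      ∀ c : Matrix ι ι k, (∀ s ∈ S, trace (c * s) = 0) → c = 0 := by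
  constructor
  · intro h c hc
    have key : ∀ x : Matrix ι ι k, trace (c * x) = 0 := by
      intro x
      have hx : x ∈ Submodule.span k S := h ▸ Submodule.mem_top
      induction hx using Submodule.span_induction with
      | mem x hx => exact hc x hx
      | zero => simp
      | add x y _ _ hx hy => simp [mul_add, hx, hy]
      | smul a x _ hx => simp [hx]
    ext i j
    simpa [trace_mul_single] using key (single j i 1)
  · intro h
    by_contra hne
    obtain ⟨f, hf0, hf⟩ := Submodule.exists_le_ker_of_lt_top _ (lt_top_iff_ne_top.mpr hne)
    have hfx : ∀ x, f x = trace ((Matrix.of fun i j => f (single j i 1)) * x) := by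
      intro x
      conv_lhs => rw [matrix_eq_sum_single x]
      simp only [map_sum, trace, diag, mul_apply, of_apply]
      rw [Finset.sum_comm]
      refine Finset.sum_congr rfl fun i _ => Finset.sum_congr rfl fun j _ => ?_
      have : single j i (x j i) = x j i • (single j i 1 : Matrix ι ι k) := by simp
      rw [this, map_smul, smul_eq_mul, mul_comm]
    have h0 := h (Matrix.of fun i j => f (single j i 1)) fun s hs => by
      rw [← hfx]; exact hf (Submodule.subset_span hs)
    apply hf0
    ext x
    rw [hfx, h0]; simp

end Span

/-! ### Burnside's theorem -/

section Burnside

variable {ι : Type} [Fintype ι] [DecidableEq ι] {k : Type*} [Field k]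

/-- The representation on the zero space is not irreducible, which excludes matrices of size zero.
-/
theorem IsAbsolutelyIrreducible.nonempty {H : Type*} [Group H] {σ : H →* GL ι k}
    (hσ : IsAbsolutelyIrreducible σ) : Nonempty ι := by
  by_contra hι
  rw [not_nonempty_iff] at hι
  unfold IsAbsolutelyIrreducible at hσ
  obtain ⟨a, b, hab⟩ := hσ.toNontrivial
  refine hab (SetLike.ext fun x => ?_)
  rw [Subsingleton.elim x 0]
  exact iff_of_true a.toSubmodule.zero_mem b.toSubmodule.zero_mem

/-- Over an algebraically closed field, the operators of an irreducible finite-dimensional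
representation span the whole endomorphism algebra. -/
theorem span_range_eq_top_of_isIrreducible {Ω V H : Type*} [Field Ω] [IsAlgClosed Ω]
    [AddCommGroup V] [Module Ω V] [FiniteDimensional Ω V] [Group H] (τ : Representation Ω H V)
    (hτ : τ.IsIrreducible) : Submodule.span Ω (Set.range τ) = ⊤ := by
  have hbij := IsSimpleModule.algebraMap_end_bijective_of_isAlgClosed
    (A := MonoidAlgebra Ω H) (V := τ.asModule) Ω
  rw [eq_top_iff]
  intro f _
  -- An `Ω`-linear map commutes with the endomorphisms of the module, all of which are scalars.
  let F : Module.End (Module.End (MonoidAlgebra Ω H) τ.asModule) τ.asModule :=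
    { toFun := fun x => τ.asModuleEquiv.symm (f (τ.asModuleEquiv x))
      map_add' := fun x y => by simp
      map_smul' := fun c x => by
        obtain ⟨a, rfl⟩ := hbij.2 c
        simp }
  obtain ⟨s, hs⟩ := (inferInstance : Module.Finite Ω V).fg_top
  classical
  obtain ⟨r, hr⟩ := jacobson_density F (s.image τ.asModuleEquiv.symm)
  have hfr : f = τ.asAlgebraHom r := by
    refine LinearMap.ext_on hs fun x hx => ?_
    have := hr (τ.asModuleEquiv.symm x) (Finset.mem_image_of_mem _ hx)
    have h2 := congrArg τ.asModuleEquiv this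
    rw [Representation.asModuleEquiv_map_smul] at h2
    simpa [F] using h2
  rw [hfr]
  clear hr hfr
  induction r using MonoidAlgebra.induction_on with
  | of g => exact Submodule.subset_span ⟨g, by simp⟩
  | add x y hx hy => rw [map_add]; exact add_mem hx hy
  | smul a x hx => rw [map_smul]; exact Submodule.smul_mem _ a hx

/-- **Burnside's theorem** over an arbitrary field. -/
theorem IsAbsolutelyIrreducible.span_eq_top {H : Type*} [Group H] {σ : H →* GL ι k}
    (hσ : IsAbsolutelyIrreducible σ) :
    Submodule.span k (Set.range fun h => (σ h : Matrix ι ι k)) = ⊤ := by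
  have h1 := span_range_eq_top_of_isIrreducible _ hσ
  rw [span_eq_top_iff_trace]
  intro c hc
  have h2 : Submodule.span (AlgebraicClosure k) (Set.range fun h =>
      (σ h : Matrix ι ι k).map (algebraMap k (AlgebraicClosure k))) = ⊤ := by
    let φ := (Matrix.toLinAlgEquiv' :
        Matrix ι ι (AlgebraicClosure k) ≃ₐ[AlgebraicClosure k] _).toLinearEquiv
    have h3 := congrArg (Submodule.map φ.symm.toLinearMap) h1
    rw [Submodule.map_span, Submodule.map_top, LinearEquiv.range, ← Set.range_comp] at h3
    rw [← h3]
    congr 2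
    ext1 h
    exact (φ.symm_apply_apply _).symm
  rw [span_eq_top_iff_trace] at h2
  have h4 := h2 (c.map (algebraMap k (AlgebraicClosure k))) (by
    rintro _ ⟨h, rfl⟩
    have := congrArg (algebraMap k (AlgebraicClosure k)) (hc _ ⟨h, rfl⟩)
    rw [map_zero] at this
    rw [← this, ← Matrix.map_mul, ← AddMonoidHom.map_trace])
  ext i j
  have := congrFun (congrFun h4 i) j
  simpa using this

end Burnside

/-! ### Minimal idempotents of finite rings -/

section FiniteRing

theorem exists_pow_isIdempotentElem {R : Type*} [Monoid R] [Finite R] (x : R) :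
    ∃ n, 0 < n ∧ IsIdempotentElem (x ^ n) := by
  obtain ⟨a, b, hab, h⟩ := Finite.exists_ne_map_eq_of_infinite fun n : ℕ => x ^ (n + 1)
  wlog hlt : a < b generalizing a b
  · exact this b a hab.symm h.symm (lt_of_le_of_ne (not_lt.mp hlt) hab.symm)
  obtain ⟨p, rfl⟩ := Nat.exists_eq_add_of_lt hlt
  -- From the exponent `a + 1` on, the powers of `x` have period `p + 1`.
  have hper : ∀ m q, x ^ (a + 1 + m + q * (p + 1)) = x ^ (a + 1 + m) := by
    intro m q
    induction q with
    | zero => simp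
    | succ q ih =>
      calc x ^ (a + 1 + m + (q + 1) * (p + 1))
          = x ^ (a + p + 1 + 1) * x ^ (m + q * (p + 1)) := by rw [← pow_add]; congr 1; ring
        _ = x ^ (a + 1 + m + q * (p + 1)) := by
          rw [← show x ^ (a + 1) = x ^ (a + p + 1 + 1) from h, ← pow_add]; congr 1; ring
        _ = _ := ih
  refine ⟨(a + 1) * (p + 1), by positivity, ?_⟩
  have := hper ((a + 1) * p) (a + 1)
  rw [IsIdempotentElem, ← pow_add]
  convert this using 2 <;> ring

/-- In a finite ring in which every nonzero right ideal contains a non-nilpotent element, the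
corner ring `e R e` of an idempotent `e` with minimal right ideal `e R ≠ 0` is a finite domain,
hence commutative by Wedderburn's little theorem. -/
theorem exists_idempotent_corner_comm (R : Type*) [Ring R] [Finite R] [Nontrivial R]
    (hR : ∀ x : R, x ≠ 0 → ∃ s, ¬ IsNilpotent (x * s)) :
    ∃ e : R, IsIdempotentElem e ∧ e ≠ 0 ∧
      ∀ x y, (e * x * e) * (e * y * e) = (e * y * e) * (e * x * e) := by
  obtain ⟨e, ⟨he, he0⟩, hmin⟩ := Set.Finite.exists_minimalFor
    (fun e : R => Set.range fun r => e * r) {e | IsIdempotentElem e ∧ e ≠ 0} (Set.toFinite _)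
    ⟨1, IsIdempotentElem.one, one_ne_zero⟩
  have he' : e * e = e := he
  -- Nonzero elements of the corner have a right inverse there: a power of a non-nilpotent element
  -- of `x R e` is a nonzero idempotent below `e`, hence equal to `e`.
  have hinv : ∀ x : R, e * x = x → x * e = x → x ≠ 0 → ∃ u, x * u = e := by
    intro x hex hxe hx
    obtain ⟨s, hs⟩ := hR x hx
    obtain ⟨n, hn, hf⟩ := exists_pow_isIdempotentElem (x * s * e)
    set f := (x * s * e) ^ n with hfdef
    have hef : e * f = f := by
      obtain ⟨n, rfl⟩ := Nat.exists_eq_succ_of_ne_zero hn.ne'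
      rw [hfdef, pow_succ', ← mul_assoc, ← mul_assoc, ← mul_assoc, hex]
    have hfe : f * e = f := by
      obtain ⟨n, rfl⟩ := Nat.exists_eq_succ_of_ne_zero hn.ne'
      rw [hfdef, pow_succ, mul_assoc, mul_assoc _ e e, he']
    have hf0 : f ≠ 0 := by
      intro h0
      have key : ∀ m, (x * s) ^ (m + 1) = (x * s * e) ^ m * (x * s) := by
        intro m
        induction m with
        | zero => simp
        | succ m ih =>
          rw [pow_succ, ih, pow_succ]
          simp only [mul_assoc]
          rw [← mul_assoc e x s, hex]
      exact hs ⟨n + 1, by rw [key, ← hfdef, h0, zero_mul]⟩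
    have hle : (Set.range fun r => e * r) ≤ Set.range fun r => f * r := by
      refine hmin (j := f) ⟨hf, hf0⟩ ?_
      rintro _ ⟨r, rfl⟩
      exact ⟨f * r, by simp only [← mul_assoc, hef]⟩
    obtain ⟨r, hr⟩ := hle ⟨e, he'⟩
    have hr' : f * r = e := hr
    have hfe2 : f = e := by
      rw [← hfe]
      conv_lhs => rw [← hr', ← mul_assoc, hf.eq]
      exact hr'
    obtain ⟨n, rfl⟩ := Nat.exists_eq_succ_of_ne_zero hn.ne'
    refine ⟨s * e * (x * s * e) ^ n, ?_⟩
    rw [← hfe2]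
    conv_rhs => rw [hfdef, pow_succ']
    rw [hfe2]
    simp only [mul_assoc]
  have hcor : ∀ z : he.Corner, e * z.1 = z.1 ∧ z.1 * e = z.1 := fun z =>
    (Subsemigroup.mem_corner_iff he).mp z.2
  have : Finite he.Corner := inferInstanceAs (Finite (Subsemigroup.corner e))
  have : NoZeroDivisors he.Corner := ⟨fun {a b} hab => by
    by_contra! hcon
    obtain ⟨u, hu⟩ := hinv b.1 (hcor b).1 (hcor b).2 fun h => hcon.2 (Subtype.ext h)
    have h1 : a.1 * b.1 = 0 := congrArg Subtype.val hab
    exact hcon.1 (Subtype.ext (by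
      calc a.1 = a.1 * e := (hcor a).2.symm
        _ = a.1 * b.1 * u := by rw [mul_assoc]; exact congrArg (a.1 * ·) hu.symm
        _ = 0 := by rw [h1, zero_mul]))⟩
  have : Nontrivial he.Corner := ⟨⟨0, 1, fun h => he0 (congrArg Subtype.val h).symm⟩⟩
  have : IsDomain he.Corner := NoZeroDivisors.to_isDomain _
  have hcomm := (Finite.isDomain_to_isField he.Corner).mul_comm
  refine ⟨e, he, he0, fun x y => ?_⟩
  exact congrArg Subtype.val (hcomm ⟨e * x * e, x, rfl⟩ ⟨e * y * e, y, rfl⟩)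

end FiniteRing

/-! ### Idempotents of rank one -/

section RankOne

variable {ι : Type*} [Fintype ι] [DecidableEq ι] {k : Type*} [Field k]

theorem mul_single_mul_apply (x y : Matrix ι ι k) (i j a b : ι) :
    (x * single i j 1 * y : Matrix ι ι k) a b = x a i * y j b := by
  simp [Matrix.mul_apply, single_apply, ite_and]

/-- An idempotent matrix whose corner in the matrix algebra is commutative has rank one. -/
theorem exists_eq_vecMulVec_of_corner_comm {e : Matrix ι ι k} (he : e * e = e) (he0 : e ≠ 0)
    (hcomm : ∀ x y, (e * x * e) * (e * y * e) = (e * y * e) * (e * x * e)) :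
    ∃ v w : ι → k, e = vecMulVec v w ∧ w ⬝ᵥ v = 1 := by
  obtain ⟨p, q, hpq⟩ : ∃ p q, e p q ≠ 0 := by
    by_contra! h
    exact he0 (Matrix.ext h)
  -- Commutation of `e (single i j 1) e` and `e (single l m 1) e`, read entrywise.
  have hent : ∀ i j l m a b, e j l * (e a i * e m b) = e m i * (e a l * e j b) := by
    intro i j l m a b
    have h := congrFun (congrFun (hcomm (single i j 1) (single l m 1)) a) b
    have h1 : ∀ x y : Matrix ι ι k, (e * x * e) * (e * y * e) = (e * x) * e * (y * e) := by
      intro x y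
      simp only [mul_assoc]
      rw [← mul_assoc e e, he]
    rw [h1, h1] at h
    have h2 : ∀ i j l m, (e * single i j 1 * e * (single l m 1 * e) : Matrix ι ι k) a b
        = e j l * (e a i * e m b) := by
      intro i j l m
      rw [← mul_assoc, mul_single_mul_apply, mul_single_mul_apply]
      ring
    rw [h2, h2] at h
    exact h
  have hsum : ∀ a b, e p q * e a b = trace e * (e a q * e p b) := by
    intro a b
    conv_lhs => rw [← congrFun (congrFun he a) b]
    rw [mul_apply, Finset.mul_sum, trace, Finset.sum_mul]
    exact Finset.sum_congr rfl fun i _ => hent i p q i a b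
  have he1 : e = vecMulVec (fun a => e a q) (fun b => trace e * (e p q)⁻¹ * e p b) := by
    ext a b
    rw [vecMulVec_apply]
    field_simp
    rw [mul_comm, hsum]
    ring
  refine ⟨_, _, he1, ?_⟩
  set v := fun a => e a q
  set w := fun b => trace e * (e p q)⁻¹ * e p b
  have h3 : (w ⬝ᵥ v) • e = e := by
    conv_rhs => rw [← he, he1, vecMulVec_mul_vecMulVec]
    rw [he1]
    ext a b; simp [vecMulVec_apply]; ring
  have h4 := congrFun (congrFun h3 p) q
  rw [Matrix.smul_apply, smul_eq_mul] at h4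
  exact mul_right_cancel₀ hpq (by rw [h4, one_mul])

/-- Over an algebraic extension of a finite field, the ring generated by a set of matrices that
spans the matrix algebra contains an idempotent of rank one. This stands in for the vanishing of
the Brauer group of such a field. -/
theorem exists_vecMulVec_mem_closure (F : Type*) [Field F] [Finite F] [Algebra F k]
    [Algebra.IsAlgebraic F k] [Nonempty ι] {S : Set (Matrix ι ι k)}
    (hS : Submodule.span k S = ⊤) :
    ∃ v w : ι → k, vecMulVec v w ∈ Subring.closure S ∧ w ⬝ᵥ v = 1 := by
  obtain ⟨t, htS, -, ht, -⟩ := Submodule.exists_finset_span_eq_linearIndepOn k S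
  rw [hS] at ht
  -- The entries of finitely many matrices generate a finite field.
  let T : Set k := ⋃ s ∈ t, ⋃ i, ⋃ j, {s i j}
  have hT : Finite T := Set.Finite.to_subtype <| t.finite_toSet.biUnion fun s _ =>
    Set.finite_iUnion fun i => Set.finite_iUnion fun j => Set.finite_singleton _
  have : FiniteDimensional F (IntermediateField.adjoin F T) :=
    IntermediateField.finiteDimensional_adjoin fun x _ => Algebra.IsIntegral.isIntegral x
  have : Finite (IntermediateField.adjoin F T) := Module.finite_of_finite F
  have hle : Subring.closure (t : Set (Matrix ι ι k)) ≤
      (algebraMap (IntermediateField.adjoin F T) k).mapMatrix.range := by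
    rw [Subring.closure_le]
    intro s hs
    refine ⟨of fun i j => ⟨s i j, IntermediateField.subset_adjoin F T ?_⟩, by ext; rfl⟩
    simp only [T, Set.mem_iUnion]
    exact ⟨s, hs, i, j, rfl⟩
  have : Finite (Subring.closure (t : Set (Matrix ι ι k))) :=
    (Set.finite_range (algebraMap (IntermediateField.adjoin F T) k).mapMatrix).subset hle
  -- If all `x s` are nilpotent, their traces vanish, and `x = 0` by the trace criterion.
  obtain ⟨e, he, he0, hcomm⟩ := exists_idempotent_corner_comm
    (Subring.closure (t : Set (Matrix ι ι k))) (by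
      intro x hx
      by_contra! hcon
      refine hx (Subtype.ext (span_eq_top_iff_trace.mp ht x.1 fun s hs => ?_))
      have h1 : IsNilpotent (x.1 * s) :=
        (hcon ⟨s, Subring.subset_closure hs⟩).map (Subring.subtype _)
      exact (isNilpotent_trace_of_isNilpotent h1).eq_zero)
  have hmem : ∀ x : Matrix ι ι k, x ∈ Submodule.span k
      (Subring.closure (t : Set (Matrix ι ι k)) : Set (Matrix ι ι k)) := fun x =>
    Submodule.span_mono Subring.subset_closure (ht ▸ Submodule.mem_top)
  obtain ⟨v, w, hvw, h1⟩ := exists_eq_vecMulVec_of_corner_comm (e := e.1)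
    (congrArg Subtype.val he) (fun h => he0 (Subtype.ext h)) (by
      intro x y
      induction hmem x using Submodule.span_induction with
      | mem x hx =>
        induction hmem y using Submodule.span_induction with
        | mem y hy => exact congrArg Subtype.val (hcomm ⟨x, hx⟩ ⟨y, hy⟩)
        | zero => simp
        | add a b _ _ ha hb => simp only [mul_add, add_mul, ha, hb]
        | smul a b _ hb => simp only [mul_smul_comm, smul_mul_assoc, hb]
      | zero => simp
      | add a b _ _ ha hb => simp only [mul_add, add_mul, ha, hb]
      | smul a b _ hb => simp only [mul_smul_comm, smul_mul_assoc, hb])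
  exact ⟨v, w, hvw ▸ Subring.closure_mono htS e.2, h1⟩

end RankOne

/-! ### Descent along a matrix coefficient -/

section Descent

variable {ι : Type*} {L : Type*} [Field L]

theorem span_transpose_eq_top {S : Set (Matrix ι ι L)} (hS : Submodule.span L S = ⊤) :
    Submodule.span L (transpose '' S) = ⊤ := by
  have h1 : (transpose : Matrix ι ι L → _) = transposeLinearEquiv ι ι L L := rfl
  rw [h1, ← LinearEquiv.coe_coe, ← Submodule.map_span, hS, Submodule.map_top, LinearEquiv.range]

variable [Fintype ι]

theorem trace_vecMulVec_mul (v w : ι → L) (x : Matrix ι ι L) :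
    trace (vecMulVec v w * x) = w ⬝ᵥ x *ᵥ v := by
  rw [vecMulVec_mul, trace_vecMulVec, dotProduct_mulVec, dotProduct_comm]

theorem mul_apply_mem (E : Subfield L) {x y : Matrix ι ι L} (hx : ∀ i j, x i j ∈ E)
    (hy : ∀ i j, y i j ∈ E) (i j : ι) : (x * y) i j ∈ E := by
  rw [mul_apply]
  exact E.sum_mem fun l _ => E.mul_mem (hx i l) (hy l j)

variable [DecidableEq ι]

theorem exists_isUnit_of_span_eq_top {S : Set (ι → L)} (hS : Submodule.span L S = ⊤) :
    ∃ f : ι → ι → L, (∀ i, f i ∈ S) ∧ IsUnit (Matrix.of f) := by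
  obtain ⟨f, hfS, -, hf⟩ := Submodule.exists_fun_fin_finrank_span_eq L S
  have hcard : Module.finrank L (Submodule.span L S) = Fintype.card ι := by
    rw [hS, finrank_top, Module.finrank_fintype_fun_eq_card]
  let φ : ι ≃ Fin (Module.finrank L (Submodule.span L S)) :=
    (Fintype.equivFin ι).trans (finCongr hcard.symm)
  refine ⟨f ∘ φ, fun i => hfS _, ?_⟩
  rw [← linearIndependent_rows_iff_isUnit]
  exact hf.comp φ φ.injective

theorem span_range_mulVec_eq_top {S : Set (Matrix ι ι L)} (hS : Submodule.span L S = ⊤)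
    {v : ι → L} (hv : v ≠ 0) : Submodule.span L ((fun x => x *ᵥ v) '' S) = ⊤ := by
  obtain ⟨j, hj⟩ := Function.ne_iff.mp hv
  have h1 : (fun x : Matrix ι ι L => x *ᵥ v) = (LinearMap.flip (mulVecBilin L L) v) := rfl
  rw [h1, ← Submodule.map_span, hS, Submodule.map_top, LinearMap.range_eq_top]
  intro u
  refine ⟨vecMulVec u (Pi.single j (v j)⁻¹), ?_⟩
  change vecMulVec u (Pi.single j (v j)⁻¹) *ᵥ v = u
  rw [vecMulVec_mulVec]
  have hj' : (v j)⁻¹ * v j = 1 := inv_mul_cancel₀ hj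
  ext i
  simp [hj']

theorem inv_apply_mem (E : Subfield L) {x : Matrix ι ι L} (hx : ∀ i j, x i j ∈ E) (i j : ι) :
    x⁻¹ i j ∈ E := by
  obtain ⟨y, rfl⟩ : ∃ y : Matrix ι ι E, E.subtype.mapMatrix y = x :=
    ⟨Matrix.of fun i j => ⟨x i j, hx i j⟩, by ext; rfl⟩
  rw [inv_def, Ring.inverse_eq_inv', ← RingHom.map_det, ← RingHom.map_adjugate, ← map_inv₀]
  exact E.mul_mem (y.det⁻¹).2 (y.adjugate i j).2

/-- Schur's lemma for a set of matrices that spans the matrix algebra. -/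
theorem exists_eq_scalar_of_commute {S : Set (Matrix ι ι L)} (hS : Submodule.span L S = ⊤)
    {x : Matrix ι ι L} (hx : ∀ s ∈ S, s * x = x * s) : ∃ a, x = scalar ι a := by
  have h : ∀ s, s * x = x * s := by
    intro s
    have hs : s ∈ Submodule.span L S := hS ▸ Submodule.mem_top
    induction hs using Submodule.span_induction with
    | mem s hs => exact hx s hs
    | zero => simp
    | add s t _ _ hs ht => rw [add_mul, mul_add, hs, ht]
    | smul a s _ hs => rw [smul_mul_assoc, mul_smul_comm, hs]
  obtain ⟨a, ha⟩ := mem_range_scalar_of_commute_single (M := x) fun i j _ => h (single i j 1)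
  exact ⟨a, ha.symm⟩

/-- A representation whose matrices span the matrix algebra can be conjugated into a subfield `E`
as soon as one matrix coefficient `h ↦ w · σ(h) v` has its values in `E`: the matrices
`Q` with rows `w σ(h'ⱼ)` and `P` with columns `σ(hᵢ) v` can be chosen invertible, both `Q P` and
`Q σ(h) P` consist of values of this coefficient, and `P⁻¹ σ(h) P = (Q P)⁻¹ (Q σ(h) P)`. -/
theorem exists_conj_mem_of_coeff_mem (E : Subfield L) {H : Type*} [Group H] (σ : H →* GL ι L)
    (hσ : Submodule.span L (Set.range fun h => (σ h : Matrix ι ι L)) = ⊤)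
    {v w : ι → L} (hv : v ≠ 0) (hw : w ≠ 0)
    (hE : ∀ h, w ⬝ᵥ (σ h : Matrix ι ι L) *ᵥ v ∈ E) :
    ∃ A : GL ι L, ∀ h i j, (A * σ h * A⁻¹ : GL ι L) i j ∈ E := by
  obtain ⟨p, hpS, hp⟩ := exists_isUnit_of_span_eq_top (span_range_mulVec_eq_top hσ hv)
  obtain ⟨q, hqS, hq⟩ := exists_isUnit_of_span_eq_top
    (span_range_mulVec_eq_top (span_transpose_eq_top hσ) hw)
  have hp' : ∀ i, ∃ h, (σ h : Matrix ι ι L) *ᵥ v = p i := fun i => by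
    obtain ⟨_, ⟨h, rfl⟩, hh⟩ := hpS i
    exact ⟨h, hh⟩
  have hq' : ∀ i, ∃ h, w ᵥ* (σ h : Matrix ι ι L) = q i := fun i => by
    obtain ⟨_, ⟨_, ⟨h, rfl⟩, rfl⟩, hh⟩ := hqS i
    exact ⟨h, by rw [← hh]; exact (mulVec_transpose _ _).symm⟩
  choose a ha using hp'
  choose b hb using hq'
  obtain ⟨P, hP⟩ : IsUnit (Matrix.of p)ᵀ := (isUnit_transpose _).mpr hp
  obtain ⟨Q, hQ⟩ := hq
  have hent : ∀ x i j, (Q.val * (σ x).val * P.val) i j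
      = w ⬝ᵥ (σ (b i * x * a j) : Matrix ι ι L) *ᵥ v := by
    intro x i j
    have h1 : ∀ y : Matrix ι ι L, (Q.val * y * P.val) i j = q i ⬝ᵥ y *ᵥ p j := by
      intro y
      rw [hP, hQ, mul_assoc]
      rfl
    rw [h1, ← ha, ← hb, map_mul, map_mul, Units.val_mul, Units.val_mul, dotProduct_mulVec,
      vecMul_vecMul, dotProduct_mulVec, vecMul_vecMul, ← dotProduct_mulVec]
  refine ⟨P⁻¹, fun h => ?_⟩
  have h1 : ((P⁻¹ * σ h * P⁻¹⁻¹ : GL ι L) : Matrix ι ι L)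
      = (Q.val * (σ 1).val * P.val)⁻¹ * (Q.val * (σ h).val * P.val) := by
    have h2 : P⁻¹ * σ h * P⁻¹⁻¹ = (Q * σ 1 * P)⁻¹ * (Q * σ h * P) := by
      rw [map_one]; group
    rw [h2, GeneralLinearGroup.coe_mul, GeneralLinearGroup.coe_inv]
    rfl
  rw [h1]
  exact mul_apply_mem E (inv_apply_mem E fun i j => hent 1 i j ▸ hE _)
    fun i j => hent h i j ▸ hE _

/-- If `φ` conjugates the matrices `σ(h)` by a fixed matrix and the rank-one matrix `v wᵀ` is
conjugated by the same matrix, then the matrix coefficient of `v` and `w` is fixed by `φ`. -/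
theorem map_coeff_eq_of_map_vecMulVec {φ : L →+* L} {v w : ι → L} {x : Matrix ι ι L}
    {N : GL ι L} (hx : x.map φ = N.val * x * N⁻¹.val)
    (hvw : (vecMulVec v w).map φ = N.val * vecMulVec v w * N⁻¹.val) :
    φ (w ⬝ᵥ x *ᵥ v) = w ⬝ᵥ x *ᵥ v := by
  rw [← trace_vecMulVec_mul]
  calc φ (trace (vecMulVec v w * x)) = trace ((vecMulVec v w).map φ * x.map φ) := by
        rw [← Matrix.map_mul, ← AddMonoidHom.map_trace]
    _ = trace (N.val * (vecMulVec v w * x) * N⁻¹.val) := by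
        rw [hx, hvw]
        simp only [mul_assoc, Units.inv_mul_cancel_left]
    _ = _ := by rw [trace_mul_cycle, Units.inv_mul, one_mul]

/-- Conjugation by a fixed matrix is multiplicative and additive, so the relation
`φ(x) = N x N⁻¹` passes to the ring generated by the matrices that satisfy it. -/
theorem map_eq_conj_of_mem_closure {R : Type*} [CommRing R] {S : Set (Matrix ι ι R)}
    {F : Type*} [CommRing F] {φ ψ : R →+* F} {N : GL ι F}
    (hS : ∀ s ∈ S, s.map φ = N.val * s.map ψ * N⁻¹.val) {x : Matrix ι ι R}
    (hx : x ∈ Subring.closure S) : x.map φ = N.val * x.map ψ * N⁻¹.val := by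
  induction hx using Subring.closure_induction with
  | mem x hx => exact hS x hx
  | zero => simp
  | one => simp
  | add x y _ _ hx hy =>
    rw [Matrix.map_add _ (map_add φ), Matrix.map_add _ (map_add ψ), hx, hy, mul_add, add_mul]
  | neg x _ hx =>
    have h : ∀ χ : R →+* F, (-x).map χ = -(x.map χ) := fun χ => by ext; simp
    rw [h, h, hx, mul_neg, neg_mul]
  | mul x y _ _ hx hy =>
    rw [Matrix.map_mul, Matrix.map_mul, hx, hy]
    simp only [mul_assoc, Units.inv_mul_cancel_left]

end Descent

/-! ### Symplectic bases -/

section Symplectic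

variable {n : Type*} [Fintype n] {E : Type*} [Field E]

theorem dotProduct_mulVec_comm_of_alternating {B : Matrix n n E} (hB : Bᵀ = -B) (x y : n → E) :
    x ⬝ᵥ B *ᵥ y = -(y ⬝ᵥ B *ᵥ x) := by
  have h : B = -Bᵀ := by rw [hB, neg_neg]
  conv_lhs => rw [h, neg_mulVec, dotProduct_neg, mulVec_transpose, dotProduct_comm,
    ← dotProduct_mulVec]

variable [DecidableEq n]

theorem dotProduct_mulVec_self_of_alternating {B : Matrix n n E} (hB : Bᵀ = -B)
    (hdiag : ∀ i, B i i = 0) (x : n → E) : x ⬝ᵥ B *ᵥ x = 0 := by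
  -- Antisymmetry makes the quadratic form additive, so it vanishes with the diagonal entries.
  let f : (n → E) →+ E :=
    { toFun := fun x => x ⬝ᵥ B *ᵥ x
      map_zero' := by simp
      map_add' := fun x y => by
        rw [mulVec_add, add_dotProduct, dotProduct_add, dotProduct_add,
          dotProduct_mulVec_comm_of_alternating hB x y]
        ring }
  change f x = 0
  rw [← Finset.univ_sum_single x, map_sum]
  refine Finset.sum_eq_zero fun i _ => ?_
  change Pi.single i (x i) ⬝ᵥ B *ᵥ Pi.single i (x i) = 0
  simp [hdiag]

/-- A nondegenerate alternating form on a space of dimension at least `2 m` admits `m` pairwise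
orthogonal hyperbolic pairs. -/
theorem exists_hyperbolic_pairs {B : Matrix n n E} (hB : Bᵀ = -B) (hdiag : ∀ i, B i i = 0)
    (hdet : B.det ≠ 0) (m : ℕ) (hm : 2 * m ≤ Fintype.card n) :
    ∃ p q : Fin m → n → E, (∀ i j, p i ⬝ᵥ B *ᵥ p j = 0) ∧ (∀ i j, q i ⬝ᵥ B *ᵥ q j = 0) ∧
      ∀ i j, p i ⬝ᵥ B *ᵥ q j = if i = j then -1 else 0 := by
  induction m with
  | zero => exact ⟨Fin.elim0, Fin.elim0, fun i => i.elim0, fun i => i.elim0, fun i => i.elim0⟩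
  | succ m ih =>
    obtain ⟨p, q, hp, hq, hpq⟩ := ih (by omega)
    have hqp : ∀ i j, q i ⬝ᵥ B *ᵥ p j = if i = j then 1 else 0 := by
      intro i j
      rw [dotProduct_mulVec_comm_of_alternating hB, hpq]
      simp only [eq_comm (a := j)]
      split_ifs <;> simp
    -- For dimension reasons some nonzero vector is orthogonal to all the given pairs.
    obtain ⟨x, hx0, hx⟩ : ∃ x : n → E, x ≠ 0 ∧
        ∀ i, p i ⬝ᵥ B *ᵥ x = 0 ∧ q i ⬝ᵥ B *ᵥ x = 0 := by
      let C : Matrix (Fin m ⊕ Fin m) n E := Matrix.of (Sum.elim p q) * B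
      have hC : LinearMap.ker (mulVecLin C) ≠ ⊥ := by
        apply LinearMap.ker_ne_bot_of_finrank_lt
        simp
        omega
      obtain ⟨x, hx, hx0⟩ := (Submodule.ne_bot_iff _).mp hC
      refine ⟨x, hx0, fun i => ?_⟩
      have h1 : Matrix.of (Sum.elim p q) *ᵥ (B *ᵥ x) = 0 := by
        rw [mulVec_mulVec]; exact hx
      exact ⟨congrFun h1 (Sum.inl i), congrFun h1 (Sum.inr i)⟩
    obtain ⟨z, hz⟩ : ∃ z, x ⬝ᵥ B *ᵥ z = -1 := by
      obtain ⟨j, hj⟩ : ∃ j, (x ᵥ* B) j ≠ 0 := by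
        by_contra! h
        exact hdet (exists_vecMul_eq_zero_iff.mp ⟨x, hx0, funext h⟩)
      refine ⟨Pi.single j (-((x ᵥ* B) j)⁻¹), ?_⟩
      rw [dotProduct_mulVec, dotProduct_single, mul_neg, mul_inv_cancel₀ hj]
    -- Subtracting its components along the given pairs makes `z` orthogonal to them.
    let y := z + ∑ i, ((p i ⬝ᵥ B *ᵥ z) • q i - (q i ⬝ᵥ B *ᵥ z) • p i)
    have hexp : ∀ u, u ⬝ᵥ B *ᵥ y = u ⬝ᵥ B *ᵥ z + ∑ i, ((p i ⬝ᵥ B *ᵥ z) * (u ⬝ᵥ B *ᵥ q i)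
        - (q i ⬝ᵥ B *ᵥ z) * (u ⬝ᵥ B *ᵥ p i)) := by
      intro u
      simp only [y, mulVec_add, dotProduct_add, mulVec_sum, dotProduct_sum, mulVec_sub,
        dotProduct_sub, mulVec_smul, dotProduct_smul, smul_eq_mul]
    have hpy : ∀ i, p i ⬝ᵥ B *ᵥ y = 0 := by
      intro i
      simp [hexp, hp, hpq]
    have hqy : ∀ i, q i ⬝ᵥ B *ᵥ y = 0 := by
      intro i
      simp [hexp, hq, hqp]
    have hxp : ∀ i, x ⬝ᵥ B *ᵥ p i = 0 := fun i => by
      rw [dotProduct_mulVec_comm_of_alternating hB, (hx i).1, neg_zero]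
    have hxq : ∀ i, x ⬝ᵥ B *ᵥ q i = 0 := fun i => by
      rw [dotProduct_mulVec_comm_of_alternating hB, (hx i).2, neg_zero]
    have hxy : x ⬝ᵥ B *ᵥ y = -1 := by simp [hexp, hxp, hxq, hz]
    have hyq : ∀ i, y ⬝ᵥ B *ᵥ q i = 0 := fun i => by
      rw [dotProduct_mulVec_comm_of_alternating hB, hqy, neg_zero]
    refine ⟨Fin.cons x p, Fin.cons y q, ?_, ?_, ?_⟩
    · intro i j
      refine Fin.cases ?_ (fun i => ?_) i <;> refine Fin.cases ?_ (fun j => ?_) j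
      · exact dotProduct_mulVec_self_of_alternating hB hdiag x
      · exact hxp j
      · exact (hx i).1
      · exact hp i j
    · intro i j
      refine Fin.cases ?_ (fun i => ?_) i <;> refine Fin.cases ?_ (fun j => ?_) j
      · exact dotProduct_mulVec_self_of_alternating hB hdiag y
      · exact hyq j
      · exact hqy i
      · exact hq i j
    · intro i j
      refine Fin.cases ?_ (fun i => ?_) i <;> refine Fin.cases ?_ (fun j => ?_) j
      · simpa using hxy
      · simpa [(Fin.succ_ne_zero j).symm] using hxq j
      · simpa using hpy i
      · simpa using hpq i j

/-- Every nondegenerate alternating matrix of size `2 m` is congruent to the standard one. -/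
theorem exists_congruent_J {m : ℕ} {B : Matrix (Fin m ⊕ Fin m) (Fin m ⊕ Fin m) E}
    (hB : Bᵀ = -B) (hdiag : ∀ i, B i i = 0) (hdet : B.det ≠ 0) :
    ∃ C : GL (Fin m ⊕ Fin m) E, C.valᵀ * B * C.val = J (Fin m) E := by
  obtain ⟨p, q, hp, hq, hpq⟩ := exists_hyperbolic_pairs hB hdiag hdet m (by simp; omega)
  have hqp : ∀ i j, q i ⬝ᵥ B *ᵥ p j = if i = j then 1 else 0 := by
    intro i j
    rw [dotProduct_mulVec_comm_of_alternating hB, hpq]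
    simp only [eq_comm (a := j)]
    split_ifs <;> simp
  let C : Matrix (Fin m ⊕ Fin m) (Fin m ⊕ Fin m) E := (Matrix.of (Sum.elim p q))ᵀ
  have hent : ∀ i j, (Cᵀ * B * C) i j = Sum.elim p q i ⬝ᵥ B *ᵥ Sum.elim p q j := by
    intro i j
    rw [mul_assoc]
    rfl
  have hC : Cᵀ * B * C = J (Fin m) E := by
    ext i j
    rw [hent]
    rcases i with i | i <;> rcases j with j | j <;>
      simp [J, hp, hq, hpq, hqp, one_apply, apply_ite (- · : E → E)]
  have hCdet : C.det ≠ 0 := by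
    intro h0
    have := congrArg det hC
    rw [det_mul, h0, mul_zero] at this
    exact (isUnit_det_J (Fin m) E).ne_zero this.symm
  exact ⟨GeneralLinearGroup.mkOfDetNeZero C hCdet, hC⟩

end Symplectic

/-! ### Descent for the linear and the symplectic group -/

section Groups

variable {ι : Type} [Fintype ι] [DecidableEq ι]

/-- The properties of a family of matrix groups that descent uses: it contains the scalar
matrices, membership can be tested over an extension field, and a matrix `A` over `L` whose coset
`A 𝒢(L)` is stable under a set `Γ` of field endomorphisms can be moved into `𝒢(L)` by left
multiplication with an invertible matrix over any field `E` whose image in `L` contains the common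
fixed field of `Γ`. -/
structure MatrixGroup.HasDescent (𝒢 : MatrixGroup.{u} ι) : Prop where
  scalars_le : ∀ (F : Type u) [Field F], scalars ι F ≤ 𝒢.pts F
  mem_of_map_mem : ∀ {F E : Type u} [Field F] [Field E] (f : F →+* E) {A : GL ι F},
    GeneralLinearGroup.map f A ∈ 𝒢.pts E → A ∈ 𝒢.pts F
  exists_map_mul_mem : ∀ {E L : Type u} [Field E] [Field L] (f : E →+* L) (Γ : Set (L →+* L)),
    (∀ x, (∀ γ ∈ Γ, γ x = x) → x ∈ f.range) → ∀ A : GL ι L,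
    (∀ γ ∈ Γ, ∃ M ∈ 𝒢.pts L, ∃ s : Lˣ,
      GeneralLinearGroup.map γ A = GeneralLinearGroup.scalar ι s * A * M) →
    ∃ B : GL ι E, GeneralLinearGroup.map f B * A ∈ 𝒢.pts L

theorem hasDescent_linear (n : ℕ) : (linear.{u} n).HasDescent where
  scalars_le _ _ := le_top
  mem_of_map_mem _ _ _ := Subgroup.mem_top _
  exists_map_mul_mem _ _ _ _ _ := ⟨1, Subgroup.mem_top _⟩

theorem scalars_le_gsp (m : ℕ) (F : Type u) [Field F] :
    scalars (Fin m ⊕ Fin m) F ≤ gsp m F := by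
  rintro _ ⟨a, rfl⟩
  refine ⟨a * a, ?_⟩
  simp [← smul_one_eq_diagonal, smul_smul]

theorem map_smul_J {m : ℕ} {F E : Type*} [Field F] [Field E] (f : F →+* E) (c : F) :
    (c • J (Fin m) F).map f = f c • J (Fin m) E := by
  rw [← map_J (Fin m) f]
  ext i j
  exact map_mul f c _

theorem mem_gsp_of_map_mem {m : ℕ} {F E : Type u} [Field F] [Field E] (f : F →+* E)
    {A : GL (Fin m ⊕ Fin m) F} (hA : GeneralLinearGroup.map f A ∈ gsp m E) : A ∈ gsp m F := by
  rcases m.eq_zero_or_pos with rfl | hm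
  · exact ⟨1, Subsingleton.elim _ _⟩
  obtain ⟨c, hc⟩ := hA
  have h1 : (A.valᵀ * J (Fin m) F * A.val).map f = (c : E) • J (Fin m) E := by
    rw [← hc, Matrix.map_mul, Matrix.map_mul, map_J]
    rfl
  -- The multiplier is an entry of `Aᵀ J A`.
  let i : Fin m := ⟨0, hm⟩
  set d := (A.valᵀ * J (Fin m) F * A.val) (Sum.inr i) (Sum.inl i) with hd
  have hdc : f d = c := by
    have := congrFun (congrFun h1 (Sum.inr i)) (Sum.inl i)
    rw [map_apply] at this
    rw [hd, this]
    simp [J]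
  have hd0 : d ≠ 0 := fun h => c.ne_zero (by rw [← hdc, h, map_zero])
  refine ⟨Units.mk0 d hd0, Matrix.map_injective f.injective ?_⟩
  change (A.valᵀ * J (Fin m) F * A.val).map f = (d • J (Fin m) F).map f
  rw [h1, map_smul_J, hdc]

/-- A coset `A GSp(L)` corresponds to the line spanned by the alternating form `A⁻ᵀ J A⁻¹`. If the
line is stable under `Γ`, then it contains a form over `E`, and a symplectic basis of the latter
gives the matrix over `E`. -/
theorem hasDescent_symplectic (m : ℕ) : (symplectic.{u} m).HasDescent where
  scalars_le F _ := scalars_le_gsp m F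
  mem_of_map_mem f _ hA := mem_gsp_of_map_mem f hA
  exists_map_mul_mem {E L} _ _ f Γ hΓ A hA := by
    -- In size zero every matrix preserves the form; otherwise it has a nonzero entry to divide by.
    rcases m.eq_zero_or_pos with rfl | hm
    · exact ⟨1, 1, Subsingleton.elim _ _⟩
    -- The transported form is semi-invariant under `Γ`, so a multiple of it is defined over `E`.
    let B : Matrix (Fin m ⊕ Fin m) (Fin m ⊕ Fin m) L := A⁻¹.valᵀ * J (Fin m) L * A⁻¹.val
    have hB : ∀ γ ∈ Γ, ∃ t : L, B.map γ = t • B := by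
      intro γ hγ
      obtain ⟨M, hM, s, hs⟩ := hA γ hγ
      obtain ⟨c, hc⟩ := (gsp m L).inv_mem hM
      have h1 : A⁻¹.val.map γ = (s⁻¹ : Lˣ).val • (M⁻¹.val * A⁻¹.val) := by
        have h2 : GeneralLinearGroup.map γ A⁻¹
            = GeneralLinearGroup.scalar _ s⁻¹ * (M⁻¹ * A⁻¹) := by
          rw [map_inv, hs, _root_.mul_inv_rev, _root_.mul_inv_rev, map_inv, ← mul_assoc,
            ← map_inv, GeneralLinearGroup.scalar_commute]
        have h3 := congrArg Units.val h2
        rw [GeneralLinearGroup.coe_mul, GeneralLinearGroup.coe_scalar] at h3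
        refine h3.trans ?_
        rw [scalar_apply, ← smul_eq_diagonal_mul]
        rfl
      refine ⟨(s⁻¹ : Lˣ).val * (s⁻¹ : Lˣ).val * c, ?_⟩
      calc B.map γ = (A⁻¹.val.map γ)ᵀ * J (Fin m) L * A⁻¹.val.map γ := by
            rw [Matrix.map_mul, Matrix.map_mul, map_J, transpose_map]
        _ = ((s⁻¹ : Lˣ).val * (s⁻¹ : Lˣ).val) •
              (A⁻¹.valᵀ * (M⁻¹.valᵀ * J (Fin m) L * M⁻¹.val) * A⁻¹.val) := by
            rw [h1]
            simp [mul_assoc, smul_smul]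
        _ = _ := by
            rw [hc]
            simp [smul_smul, B]
    have hBdet : B.det ≠ 0 := by
      have h0 : A⁻¹.val.det ≠ 0 := GeneralLinearGroup.det_ne_zero _
      rw [det_mul, det_mul, det_transpose]
      exact mul_ne_zero (mul_ne_zero h0 (isUnit_det_J (Fin m) L).ne_zero) h0
    have hBt : Bᵀ = -B := by
      simp only [B, transpose_mul, transpose_transpose, J_transpose]
      simp [mul_assoc]
    have hBdiag : ∀ i, B i i = 0 := by
      intro i
      have hJdiag : ∀ j, J (Fin m) L j j = 0 := by rintro (j | j) <;> simp [J]
      have h1 := dotProduct_mulVec_self_of_alternating (J_transpose (Fin m) L) hJdiag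
        (fun j => A⁻¹.val j i)
      rw [← h1]
      change (A⁻¹.valᵀ * J (Fin m) L * A⁻¹.val) i i = _
      rw [mul_assoc]
      rfl
    obtain ⟨i, j, hij⟩ : ∃ i j, B i j ≠ 0 := by
      by_contra! h
      have : B = 0 := Matrix.ext h
      have : Nonempty (Fin m ⊕ Fin m) := ⟨Sum.inl ⟨0, hm⟩⟩
      exact hBdet (by rw [‹B = 0›, det_zero])
    have hE : ∀ a b, ∃ x, f x = (B i j)⁻¹ * B a b := by
      intro a b
      refine hΓ _ fun γ hγ => ?_
      obtain ⟨t, ht⟩ := hB γ hγ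
      have hent : ∀ a b, γ (B a b) = t * B a b := fun a b => congrFun (congrFun ht a) b
      have ht0 : t ≠ 0 := by
        rintro rfl
        have := hent i j
        rw [zero_mul, map_eq_zero] at this
        exact hij this
      rw [map_mul, map_inv₀, hent, hent]
      field_simp
    choose D hD using hE
    have hDB : (Matrix.of D).map f = (B i j)⁻¹ • B := by
      ext a b
      exact hD a b
    have hDt : (Matrix.of D)ᵀ = -Matrix.of D := by
      ext a b
      apply f.injective
      have := congrFun (congrFun hBt a) b
      rw [transpose_apply, Matrix.neg_apply] at this
      change f (D b a) = f (-D a b)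
      rw [map_neg, hD, hD, this, mul_neg]
    have hDdiag : ∀ a, Matrix.of D a a = 0 := by
      intro a
      apply f.injective
      change f (D a a) = _
      rw [hD, hBdiag, mul_zero, map_zero]
    have hDdet : (Matrix.of D).det ≠ 0 := by
      intro h
      have h1 := congrArg f h
      rw [RingHom.map_det, map_zero] at h1
      change ((Matrix.of D).map f).det = 0 at h1
      rw [hDB, det_smul] at h1
      exact mul_ne_zero (pow_ne_zero _ (inv_ne_zero hij)) hBdet h1
    obtain ⟨C, hC⟩ := exists_congruent_J hDt hDdiag hDdet
    refine ⟨C⁻¹, ?_⟩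
    have hmem : A⁻¹ * GeneralLinearGroup.map f C ∈ gsp m L := by
      refine ⟨Units.mk0 (B i j) hij, ?_⟩
      have h1 : (C.valᵀ * Matrix.of D * C.val).map f = J (Fin m) L := by
        rw [hC]; exact map_J (Fin m) f
      rw [Matrix.map_mul, Matrix.map_mul, hDB, transpose_map] at h1
      calc (A⁻¹ * GeneralLinearGroup.map f C).valᵀ * J (Fin m) L
            * (A⁻¹ * GeneralLinearGroup.map f C).val
          = (C.val.map f)ᵀ * B * C.val.map f := by
            simp only [GeneralLinearGroup.coe_mul, transpose_mul, B, mul_assoc]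
            rfl
        _ = B i j • ((C.val.map f)ᵀ * ((B i j)⁻¹ • B) * C.val.map f) := by
            rw [mul_smul_comm, smul_mul_assoc, smul_smul, mul_inv_cancel₀ hij, one_smul]
        _ = B i j • J (Fin m) L := by rw [h1]
    have := (gsp m L).inv_mem hmem
    rwa [_root_.mul_inv_rev, inv_inv, ← map_inv] at this

end Groups

/-! ### Projective matrix groups -/

section Projective

variable {ι : Type} [Fintype ι] [DecidableEq ι] {𝒢 : MatrixGroup.{u} ι}

theorem scalar_mul_apply {L : Type*} [Field L] (a : Lˣ) (x : GL ι L) (i j : ι) :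
    (GeneralLinearGroup.scalar ι a * x : GL ι L) i j = a * x i j := by
  rw [GeneralLinearGroup.coe_mul, GeneralLinearGroup.coe_scalar, scalar_apply, diagonal_mul]

theorem exists_apply_ne_zero [Nonempty ι] {L : Type*} [Field L] (x : GL ι L) :
    ∃ i j, x i j ≠ 0 := by
  by_contra! h
  refine x.det_ne_zero ?_
  rw [show x.val = 0 from Matrix.ext h, det_zero]

theorem Proj.mk_eq_mk_iff {L : Type u} [Field L] {x y : 𝒢.pts L} :
    (x : Proj 𝒢 L) = y ↔
      ∃ a : Lˣ, (y : GL ι L) = GeneralLinearGroup.scalar ι a * (x : GL ι L) := by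
  rw [QuotientGroup.eq]
  constructor
  · rintro ⟨a, ha⟩
    refine ⟨a, ?_⟩
    rw [GeneralLinearGroup.scalar_commute, ha]
    simp
  · rintro ⟨a, ha⟩
    refine ⟨a, ?_⟩
    change _ = (x : GL ι L)⁻¹ * (y : GL ι L)
    rw [ha, GeneralLinearGroup.scalar_commute, inv_mul_cancel_left]

theorem Proj.map_injective [Nonempty ι] {F L : Type u} [Field F] [Field L] (f : F →+* L) :
    Function.Injective (Proj.map 𝒢 f) := by
  intro a b hab
  induction a using QuotientGroup.induction_on with | H x => ?_
  induction b using QuotientGroup.induction_on with | H y => ?_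
  obtain ⟨a, ha⟩ := Proj.mk_eq_mk_iff.mp (show ((𝒢.map f x : 𝒢.pts L) : Proj 𝒢 L) = 𝒢.map f y
    from hab)
  obtain ⟨i, j, hij⟩ := exists_apply_ne_zero (x : GL ι F)
  have hent : ∀ k l, f ((y : GL ι F) k l) = a * f ((x : GL ι F) k l) := by
    intro k l
    have := congrArg (fun z : GL ι L => z k l) ha
    rw [scalar_mul_apply] at this
    exact this
  have hfij : f ((x : GL ι F) i j) ≠ 0 := (map_ne_zero f).mpr hij
  have hac : f ((y : GL ι F) i j / (x : GL ι F) i j) = a := by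
    rw [map_div₀, hent]; field_simp
  have hc : (y : GL ι F) i j / (x : GL ι F) i j ≠ 0 := fun h =>
    a.ne_zero (by rw [← hac, h, map_zero])
  refine Proj.mk_eq_mk_iff.mpr ⟨Units.mk0 _ hc, GeneralLinearGroup.ext fun k l => ?_⟩
  rw [scalar_mul_apply]
  apply f.injective
  rw [map_mul, Units.val_mk0, hac, hent]

theorem MatrixGroup.continuous_map (𝒢 : MatrixGroup.{u} ι) {F L : Type u} [Field F] [Field L]
    [TopologicalSpace F] [TopologicalSpace L] {f : F →+* L} (hf : Continuous f) :
    Continuous (𝒢.map f) := by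
  refine Continuous.subtype_mk ?_ _
  have h : Continuous (GeneralLinearGroup.map (n := ι) f) :=
    Units.continuous_iff.mpr ⟨Units.continuous_val.matrix_map hf,
      Units.continuous_coe_inv.matrix_map hf⟩
  exact h.comp continuous_subtype_val

theorem Proj.continuous_map {F L : Type u} [Field F] [Field L] [TopologicalSpace F]
    [TopologicalSpace L] {f : F →+* L} (hf : Continuous f) : Continuous (Proj.map 𝒢 f) :=
  continuous_quot_lift _ (continuous_quotient_mk'.comp (𝒢.continuous_map hf))

end Projective

/-! ### Projective representations from ratios of matrix entries -/

section Construction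

variable {ι : Type} [Fintype ι] [DecidableEq ι] {𝒢 : MatrixGroup.{u} ι}
  {G : Type w} [Group G] [TopologicalSpace G]
  {L : Type u} [Field L] [TopologicalSpace L]
  {K : Type v} [Field K] [Algebra K L]

theorem continuous_apply_coe {X : Type*} [TopologicalSpace X] {x : X → 𝒢.pts L}
    (hx : Continuous x) (i j : ι) : Continuous fun t => (x t : GL ι L) i j :=
  (Units.continuous_val.comp (continuous_subtype_val.comp hx)).matrix_elem i j

variable [IsTopologicalRing L] [ContinuousInv₀ L]

/-- If the ratios of the matrix entries of a conjugate of `ρ` lie in `F`, then dividing locally by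
a nonvanishing entry gives continuous lifts of a projective representation over `F`. -/
theorem projDefinedOver_of_div_mem [T1Space L] [Nonempty ι] (h𝒢 : 𝒢.HasDescent) (ρ : G →ₜ* 𝒢.pts L)
    (F : IntermediateField K L) (A : 𝒢.pts L)
    (hA : ∀ g i j k l, (A * ρ g * A⁻¹ : 𝒢.pts L).val k l / (A * ρ g * A⁻¹ : 𝒢.pts L).val i j ∈ F) :
    ProjDefinedOver 𝒢 ρ F := by
  set τ : G → 𝒢.pts L := fun g => A * ρ g * A⁻¹ with hτ
  -- The lift obtained by dividing by the entry `(i, j)`.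
  have hlift : ∀ i j g, ∃ y : 𝒢.pts F, (τ g).val i j ≠ 0 →
      (∀ k l, ((y : GL ι F) k l : L) = ((τ g).val i j)⁻¹ * (τ g).val k l) ∧
      (∀ k l, (((y⁻¹ : 𝒢.pts F) : GL ι F) k l : L) =
        (τ g).val i j * ((τ g)⁻¹ : 𝒢.pts L).val k l) := by
    intro i j g
    by_cases h : (τ g).val i j = 0
    · exact ⟨1, fun h' => (h' h).elim⟩
    let c : Lˣ := Units.mk0 _ h
    let x : Matrix ι ι F := Matrix.of fun k l => ⟨_, hA g i j k l⟩
    have hx : x.map (algebraMap F L) = (GeneralLinearGroup.scalar ι c⁻¹ * τ g : GL ι L).val := by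
      ext k l
      rw [scalar_mul_apply]
      change (τ g).val k l / (τ g).val i j = (((τ g).val i j)⁻¹) * _
      rw [div_eq_inv_mul]
    have hdet : x.det ≠ 0 := by
      intro h0
      have := congrArg (algebraMap F L) h0
      rw [RingHom.map_det, map_zero] at this
      change (x.map (algebraMap F L)).det = 0 at this
      rw [hx] at this
      exact GeneralLinearGroup.det_ne_zero _ this
    let y := GeneralLinearGroup.mkOfDetNeZero x hdet
    have hy : GeneralLinearGroup.map (algebraMap F L) y
        = GeneralLinearGroup.scalar ι c⁻¹ * τ g := Units.ext hx
    have hmem : y ∈ 𝒢.pts F := by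
      apply h𝒢.mem_of_map_mem (algebraMap F L)
      rw [hy]
      exact mul_mem (h𝒢.scalars_le L ⟨_, rfl⟩) (τ g).2
    refine ⟨⟨y, hmem⟩, fun _ => ⟨fun k l => ?_, fun k l => ?_⟩⟩
    · have := congrArg (fun z : GL ι L => z k l) hy
      rw [scalar_mul_apply] at this
      exact this
    · have hy' : GeneralLinearGroup.map (algebraMap F L) y⁻¹
          = GeneralLinearGroup.scalar ι c * (τ g : GL ι L)⁻¹ := by
        rw [map_inv, hy, _root_.mul_inv_rev, ← map_inv, inv_inv, GeneralLinearGroup.scalar_commute]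
      have := congrArg (fun z : GL ι L => z k l) hy'
      rw [scalar_mul_apply] at this
      exact this
  choose y hy hyinv using hlift
  have hymap : ∀ i j g (h : (τ g).val i j ≠ 0),
      Proj.map 𝒢 (algebraMap F L) (y i j g : Proj 𝒢 F) = (τ g : Proj 𝒢 L) := by
    intro i j g h
    refine (Proj.mk_eq_mk_iff.mpr ⟨(Units.mk0 _ h)⁻¹, GeneralLinearGroup.ext fun k l => ?_⟩).symm
    rw [scalar_mul_apply]
    exact hy i j g h k l
  have hne : ∀ g, ∃ r : Proj 𝒢 F, Proj.map 𝒢 (algebraMap F L) r = (τ g : Proj 𝒢 L) := fun g => by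
    obtain ⟨i, j, hij⟩ := exists_apply_ne_zero (τ g : GL ι L)
    exact ⟨_, hymap i j g hij⟩
  choose r hr using hne
  have hinj := Proj.map_injective (𝒢 := 𝒢) (algebraMap F L)
  have hτcont : Continuous τ := (continuous_const.mul ρ.continuous_toFun).mul continuous_const
  have hrcont : Continuous r := by
    rw [continuous_iff_continuousAt]
    intro g₀
    obtain ⟨i, j, hij⟩ := exists_apply_ne_zero (τ g₀ : GL ι L)
    have hU : IsOpen {g | (τ g).val i j ≠ 0} :=
      isOpen_ne_fun (continuous_apply_coe hτcont i j) continuous_const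
    suffices h : ContinuousOn r {g | (τ g).val i j ≠ 0} from h.continuousAt (hU.mem_nhds hij)
    rw [continuousOn_iff_continuous_domRestrict]
    have hry : Set.domRestrict {g | (τ g).val i j ≠ 0} r =
        fun g : {g | (τ g).val i j ≠ 0} => ((y i j g : 𝒢.pts F) : Proj 𝒢 F) := by
      ext g
      exact hinj ((hr g).trans (hymap i j g g.2).symm)
    rw [hry]
    refine continuous_quotient_mk'.comp
      (Continuous.subtype_mk (Units.continuous_iff.mpr ⟨?_, ?_⟩) _)
    · refine continuous_matrix fun k l => continuous_induced_rng.mpr ?_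
      have : Continuous fun g : {g | (τ g).val i j ≠ 0} =>
          ((τ g).val i j)⁻¹ * (τ g).val k l :=
        (((continuous_apply_coe hτcont i j).comp continuous_subtype_val).inv₀ fun g => g.2).mul
          ((continuous_apply_coe hτcont k l).comp continuous_subtype_val)
      exact this.congr fun g => (hy i j g g.2 k l).symm
    · refine continuous_matrix fun k l => continuous_induced_rng.mpr ?_
      have : Continuous fun g : {g | (τ g).val i j ≠ 0} =>
          (τ g).val i j * ((τ g)⁻¹ : 𝒢.pts L).val k l :=
        ((continuous_apply_coe hτcont i j).comp continuous_subtype_val).mul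
          ((continuous_apply_coe hτcont.inv k l).comp continuous_subtype_val)
      exact this.congr fun g => (hyinv i j g g.2 k l).symm
  have hτmul : ∀ g h, τ (g * h) = τ g * τ h := fun g h => by
    simp only [hτ, map_mul]; group
  let r' : G →ₜ* Proj 𝒢 F :=
    { toFun := r
      map_one' := hinj (by rw [hr, map_one]; simp [hτ])
      map_mul' := fun g h => hinj (by rw [hr, map_mul, hr, hr, hτmul]; rfl)
      continuous_toFun := hrcont }
  refine ⟨⟨(Proj.map 𝒢 (algebraMap F L)).comp r'.toMonoidHom,
    (Proj.continuous_map continuous_subtype_val).comp hrcont⟩, ⟨A, fun g => ?_⟩, r', fun g => rfl⟩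
  exact hr g

end Construction

/-! ### Inner twists and fields of definition -/

section MainArgument

variable {ι : Type} [Fintype ι] [DecidableEq ι] {𝒢 : MatrixGroup.{u} ι}
  {G : Type w} [Group G] [TopologicalSpace G]
  {L : Type u} [Field L] [TopologicalSpace L]
  {K : Type v} [Field K] [Algebra K L]

/-- The matrix of an inner twist conjugates `ρ` to `^γ ρ` up to scalars, and exactly on the kernel
`I_[ρ]`, where the character of the twist is trivial. -/
theorem exists_conj_of_mem_twistGalois {ρ : G →ₜ* 𝒢.pts L} {γ : L ≃ₐ[K] L}
    (hγ : γ ∈ twistGalois 𝒢 ρ K) :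
    ∃ M : 𝒢.pts L, (∀ g, ∃ a : Lˣ, GeneralLinearGroup.map (γ : L →+* L) (ρ g : GL ι L) =
        GeneralLinearGroup.scalar ι a * ((M : GL ι L) * (ρ g : GL ι L) * (M : GL ι L)⁻¹)) ∧
      ∀ h, GeneralLinearGroup.map (γ : L →+* L) (restrictTwistKernel 𝒢 ρ K h) =
        (M : GL ι L) * restrictTwistKernel 𝒢 ρ K h * (M : GL ι L)⁻¹ := by
  obtain ⟨ε, M, hM⟩ := hγ
  refine ⟨M, fun g => ⟨ε g, ?_⟩, fun h => ?_⟩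
  · rw [hM, ← mul_assoc, ← GeneralLinearGroup.scalar_commute]
    simp only [mul_assoc]
  · have h1 : ε h = 1 := by
      have := h.2
      simp only [twistKernel, Subgroup.mem_iInf] at this
      exact this ε ⟨γ, M, hM⟩
    have := hM h
    rw [h1, map_one, one_mul] at this
    exact this

/-- If `ρ|_{I_[ρ]}` spans the matrix algebra and has a matrix coefficient with values in `K_[ρ]`,
then `ρ^proj` is defined over `K_[ρ]`: a matrix `A` that conjugates the restriction into `K_[ρ]`
satisfies `γ(A) = s A M⁻¹` for the matrix `M` of any inner twist by `γ`, so `γ` acts on each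
`A ρ(g) A⁻¹` by a scalar. -/
theorem projDefinedOver_twistField [IsTopologicalRing L] [ContinuousInv₀ L] [T1Space L]
    [Nonempty ι] (h𝒢 : 𝒢.HasDescent) (ρ : G →ₜ* 𝒢.pts L)
    (hspan : Submodule.span L
      (Set.range fun h => (restrictTwistKernel 𝒢 ρ K h : Matrix ι ι L)) = ⊤)
    {v w : ι → L} (hv : v ≠ 0) (hw : w ≠ 0)
    (hvw : ∀ γ ∈ twistGalois 𝒢 ρ K, ∀ h,
      γ (w ⬝ᵥ (restrictTwistKernel 𝒢 ρ K h : Matrix ι ι L) *ᵥ v) =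
        w ⬝ᵥ (restrictTwistKernel 𝒢 ρ K h : Matrix ι ι L) *ᵥ v) :
    ProjDefinedOver 𝒢 ρ (twistField 𝒢 ρ K) := by
  set σ := restrictTwistKernel 𝒢 ρ K with hσ
  obtain ⟨A₀, hA₀⟩ := exists_conj_mem_of_coeff_mem (twistField 𝒢 ρ K).toSubfield σ hspan hv hw
    fun h γ hγ => hvw γ hγ h
  have key : ∀ γ ∈ twistGalois 𝒢 ρ K, ∀ M : GL ι L,
      (∀ h, GeneralLinearGroup.map (γ : L →+* L) (σ h) = M * σ h * M⁻¹) →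
      ∃ s : Lˣ, GeneralLinearGroup.map (γ : L →+* L) A₀
        = GeneralLinearGroup.scalar ι s * A₀ * M⁻¹ := by
    intro γ hγ M hM
    have hfix : ∀ h, GeneralLinearGroup.map (γ : L →+* L) (A₀ * σ h * A₀⁻¹) = A₀ * σ h * A₀⁻¹ :=
      fun h => GeneralLinearGroup.ext fun i j => hA₀ h i j γ hγ
    -- This matrix commutes with all `σ h`, so it is a scalar by Schur's lemma.
    let x := A₀⁻¹ * GeneralLinearGroup.map (γ : L →+* L) A₀ * M
    have hx : ∀ h, σ h * x = x * σ h := by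
      intro h
      have h1 := hfix h
      rw [map_mul, map_mul, hM, map_inv] at h1
      calc σ h * x = A₀⁻¹ * (A₀ * σ h * A₀⁻¹) * GeneralLinearGroup.map (γ : L →+* L) A₀ * M := by
            simp only [x]; group
        _ = x * σ h := by rw [← h1]; simp only [x]; group
    obtain ⟨a, ha⟩ := exists_eq_scalar_of_commute hspan (x := x.val) (by
      rintro _ ⟨h, rfl⟩
      exact congrArg Units.val (hx h))
    have ha0 : a ≠ 0 := by
      rintro rfl
      refine x.det_ne_zero ?_
      rw [ha, map_zero, det_zero]
    have hxa : x = GeneralLinearGroup.scalar ι (Units.mk0 a ha0) := Units.ext ha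
    refine ⟨Units.mk0 a ha0, ?_⟩
    rw [GeneralLinearGroup.scalar_commute, ← hxa]
    simp only [x]; group
  -- Multiplication by a matrix over the twist field keeps the relation `γ(A) = s A M⁻¹`.
  obtain ⟨B, hB⟩ := h𝒢.exists_map_mul_mem (algebraMap (twistField 𝒢 ρ K) L)
    ((fun γ : L ≃ₐ[K] L => (γ : L →+* L)) '' twistGalois 𝒢 ρ K)
    (fun x hx => ⟨⟨x, fun γ hγ => hx _ ⟨γ, hγ, rfl⟩⟩, rfl⟩) A₀ (by
      rintro _ ⟨γ, hγ, rfl⟩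
      obtain ⟨M, -, hM⟩ := exists_conj_of_mem_twistGalois hγ
      obtain ⟨s, hs⟩ := key γ hγ M hM
      exact ⟨_, inv_mem M.2, s, hs⟩)
  set B' := GeneralLinearGroup.map (algebraMap (twistField 𝒢 ρ K) L) B with hB'
  refine projDefinedOver_of_div_mem h𝒢 ρ _ ⟨B' * A₀, hB⟩ fun g i j k l γ hγ => ?_
  obtain ⟨M, hMρ, hM⟩ := exists_conj_of_mem_twistGalois hγ
  obtain ⟨s, hs⟩ := key γ hγ M hM
  obtain ⟨a, ha⟩ := hMρ g
  have hBfix : GeneralLinearGroup.map (γ : L →+* L) B' = B' :=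
    GeneralLinearGroup.ext fun i j => (B i j).2 γ hγ
  have h1 : GeneralLinearGroup.map (γ : L →+* L) (B' * A₀ * (ρ g : GL ι L) * (B' * A₀)⁻¹)
      = GeneralLinearGroup.scalar ι a * (B' * A₀ * (ρ g : GL ι L) * (B' * A₀)⁻¹) := by
    have h2 : GeneralLinearGroup.map (γ : L →+* L) (B' * A₀)
        = GeneralLinearGroup.scalar ι s * (B' * A₀ * (M : GL ι L)⁻¹) := by
      rw [map_mul, hBfix, hs, ← mul_assoc, ← mul_assoc, ← GeneralLinearGroup.scalar_commute]
      simp only [mul_assoc]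
    rw [map_mul, map_mul, map_inv, h2, ha, _root_.mul_inv_rev, ← map_inv]
    have h3 : ∀ (b c : Lˣ) (x y z : GL ι L), GeneralLinearGroup.scalar ι b * x *
        (GeneralLinearGroup.scalar ι c * y) * (z * GeneralLinearGroup.scalar ι b⁻¹)
        = GeneralLinearGroup.scalar ι c * (x * y * z) := by
      intro b c x y z
      calc _ = GeneralLinearGroup.scalar ι b * (x * (GeneralLinearGroup.scalar ι c * y) * z)
            * GeneralLinearGroup.scalar ι b⁻¹ := by simp only [mul_assoc]
        _ = x * (GeneralLinearGroup.scalar ι c * y) * z := by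
            rw [GeneralLinearGroup.scalar_commute, map_inv, mul_inv_cancel_right]
        _ = _ := by
            rw [← mul_assoc x, ← GeneralLinearGroup.scalar_commute]
            simp only [mul_assoc]
    rw [h3]
    congr 1
    group
  have hent : ∀ k l, γ ((B' * A₀ * (ρ g : GL ι L) * (B' * A₀)⁻¹ : GL ι L) k l)
      = a * (B' * A₀ * (ρ g : GL ι L) * (B' * A₀)⁻¹ : GL ι L) k l := by
    intro k l
    have := congrArg (fun z : GL ι L => z k l) h1
    rw [scalar_mul_apply] at this
    exact this
  refine (map_div₀ γ _ _).trans ?_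
  refine (congrArg₂ (· / ·) (hent k l) (hent i j)).trans ?_
  exact mul_div_mul_left _ _ a.ne_zero

/-- A model of `ρ^proj` over `F` produces an inner twist for every automorphism over `F`. -/
theorem mem_twistGalois_of_projDefinedOver [IsTopologicalRing L] [ContinuousInv₀ L]
    [Nonempty ι] {γ : L ≃ₐ[K] L} (hcont : Continuous γ) {ρ : G →ₜ* 𝒢.pts L}
    {F : IntermediateField K L} (hF : ProjDefinedOver 𝒢 ρ F) (hγ : ∀ x ∈ F, γ x = x) :
    γ ∈ twistGalois 𝒢 ρ K := by
  obtain ⟨r, ⟨N, hN⟩, r', hr'⟩ := hF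
  set τ : G → 𝒢.pts L := fun g => N * ρ g * N⁻¹ with hτ
  have hτcont : Continuous τ := (continuous_const.mul ρ.continuous_toFun).mul continuous_const
  have hτmul : ∀ g h, τ (g * h) = τ g * τ h := fun g h => by
    simp only [hτ, map_mul]; group
  have hmap : ∀ g, ∃ a : Lˣ, GeneralLinearGroup.map (γ : L →+* L) (τ g : GL ι L)
      = GeneralLinearGroup.scalar ι a * (τ g : GL ι L) := by
    intro g
    obtain ⟨y, hy⟩ := QuotientGroup.mk_surjective (r' g)
    have h1 : ((𝒢.map (algebraMap F L) y : 𝒢.pts L) : Proj 𝒢 L) = (τ g : Proj 𝒢 L) := by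
      have h2 := hr' g
      rw [← hy, hN] at h2
      exact h2.symm
    obtain ⟨a, ha⟩ := Proj.mk_eq_mk_iff.mp h1
    have hyfix : GeneralLinearGroup.map (γ : L →+* L) (𝒢.map (algebraMap F L) y : GL ι L)
        = (𝒢.map (algebraMap F L) y : GL ι L) :=
      GeneralLinearGroup.ext fun i j => hγ _ ((y : GL ι F) i j).2
    refine ⟨Units.map (γ : L →* L) a * a⁻¹, ?_⟩
    rw [ha, map_mul, hyfix, GeneralLinearGroup.map_scalar, map_mul, map_inv, mul_assoc,
      inv_mul_cancel_left]
    rfl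
  choose ε hε using hmap
  -- The scalar `ε(g)` is a diagonal entry of `^γ τ(g) τ(g)⁻¹`.
  have hε' : ∀ g, GeneralLinearGroup.scalar ι (ε g)
      = GeneralLinearGroup.map (γ : L →+* L) (τ g : GL ι L) * (τ g : GL ι L)⁻¹ := fun g => by
    rw [hε, mul_inv_cancel_right]
  have i : ι := Classical.arbitrary ι
  have hscal : ∀ a : Lˣ, (GeneralLinearGroup.scalar ι a : GL ι L) i i = a := fun a => by
    rw [GeneralLinearGroup.coe_scalar, scalar_apply, diagonal_apply_eq]
  have hinj : Function.Injective (GeneralLinearGroup.scalar ι : Lˣ →* GL ι L) := fun a b hab => by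
    ext
    rw [← hscal a, hab, hscal]
  have hxcont : Continuous fun g => GeneralLinearGroup.scalar ι (ε g) := by
    simp_rw [hε']
    have h1 : Continuous fun g => (τ g : GL ι L) := continuous_subtype_val.comp hτcont
    refine Continuous.mul ?_ h1.inv
    exact continuous_subtype_val.comp ((𝒢.continuous_map (f := (γ : L →+* L)) hcont).comp hτcont)
  let ε' : G →ₜ* Lˣ :=
    { toFun := ε
      map_one' := hinj (by rw [hε', map_one]; simp [hτ])
      map_mul' := fun g h => hinj (by
        rw [hε', hτmul, map_mul, Subgroup.coe_mul, map_mul, _root_.mul_inv_rev, hε h,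
          ← mul_assoc, mul_assoc (GeneralLinearGroup.map _ _), mul_inv_cancel_right,
          ← GeneralLinearGroup.scalar_commute, hε g]
        rw [← mul_assoc, mul_inv_cancel_right, ← map_mul, ← map_mul, mul_comm])
      continuous_toFun := by
        refine Units.continuous_iff.mpr ⟨?_, ?_⟩
        · refine ((Units.continuous_val.comp hxcont).matrix_elem i i).congr fun g => ?_
          exact hscal _
        · refine ((Units.continuous_val.comp hxcont.inv).matrix_elem i i).congr fun g => ?_
          rw [Function.comp_apply, Pi.inv_apply, ← map_inv]
          exact hscal _ }
  refine ⟨ε', (𝒢.map (γ : L →+* L) N)⁻¹ * N, fun g => ?_⟩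
  have h1 : (ρ g : GL ι L) = (N : GL ι L)⁻¹ * (τ g : GL ι L) * N := by
    simp only [hτ, Subgroup.coe_mul, Subgroup.coe_inv]; group
  have h2 : (((𝒢.map (γ : L →+* L) N)⁻¹ * N : 𝒢.pts L) : GL ι L)
      = (GeneralLinearGroup.map (γ : L →+* L) (N : GL ι L))⁻¹ * N := rfl
  rw [h1, map_mul, map_mul, map_inv, hε, h2]
  change _ = _ * (GeneralLinearGroup.scalar ι (ε g) * _) * _
  generalize (τ g : GL ι L) = t
  generalize GeneralLinearGroup.map (γ : L →+* L) (N : GL ι L) = n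
  have h3 : GeneralLinearGroup.scalar ι (ε g) * ((N : GL ι L)⁻¹ * t * N)
      = (N : GL ι L)⁻¹ * (GeneralLinearGroup.scalar ι (ε g) * t) * N := by
    simp only [← mul_assoc, GeneralLinearGroup.scalar_commute _ (N : GL ι L)⁻¹]
  rw [h3]
  group

theorem twistField_le_of_projDefinedOver [IsTopologicalRing L] [ContinuousInv₀ L] [IsGalois K L]
    [Nonempty ι] (hcont : ∀ γ : L ≃ₐ[K] L, Continuous γ) {ρ : G →ₜ* 𝒢.pts L}
    {F : IntermediateField K L} (hF : ProjDefinedOver 𝒢 ρ F) : twistField 𝒢 ρ K ≤ F := by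
  intro x hx
  rw [← InfiniteGalois.fixedField_fixingSubgroup F, IntermediateField.mem_fixedField_iff]
  intro γ hγ
  exact hx γ (mem_twistGalois_of_projDefinedOver (hcont γ) hF fun y hy => hγ ⟨y, hy⟩)

end MainArgument

/-! ### Henselian valuation rings -/

section Henselian

open Polynomial IsLocalRing

theorem isUnit_add_of_mem_maximalIdeal {R : Type*} [CommRing R] [IsLocalRing R] {u x : R}
    (hu : IsUnit u) (hx : x ∈ maximalIdeal R) : IsUnit (u + x) := by
  by_contra h
  have h1 : u ∈ maximalIdeal R := by
    have := sub_mem ((mem_maximalIdeal _).mpr h) hx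
    rwa [add_sub_cancel_right] at this
  exact (mem_maximalIdeal _).mp h1 hu

theorem isUnit_eval_of_sub_mem {R : Type*} [CommRing R] [IsLocalRing R] {f : R[X]} {a₀ a : R}
    (hf : IsUnit (f.eval a₀)) (ha : a - a₀ ∈ maximalIdeal R) : IsUnit (f.eval a) := by
  obtain ⟨z, hz⟩ := f.evalSubFactor a a₀
  rw [sub_eq_iff_eq_add'] at hz
  rw [hz]
  exact isUnit_add_of_mem_maximalIdeal hf (Ideal.mul_mem_left _ _ ha)

/-- The uniqueness half of Hensel's lemma, valid in every local ring. -/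
theorem root_unique_of_isUnit_derivative {R : Type*} [CommRing R] [IsLocalRing R] {f : R[X]}
    {a₀ a b : R} (hf : IsUnit (f.derivative.eval a₀)) (ha : f.IsRoot a) (hb : f.IsRoot b)
    (ha₀ : a - a₀ ∈ maximalIdeal R) (hb₀ : b - a₀ ∈ maximalIdeal R) : a = b := by
  have hab : b - a ∈ maximalIdeal R := by
    have := sub_mem hb₀ ha₀
    rwa [sub_sub_sub_cancel_right] at this
  obtain ⟨k, hk⟩ := f.binomExpansion a (b - a)
  rw [add_sub_cancel, hb.eq_zero, ha.eq_zero, zero_add, sq, ← mul_assoc, ← add_mul] at hk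
  have h1 := isUnit_add_of_mem_maximalIdeal (isUnit_eval_of_sub_mem hf ha₀)
    (Ideal.mul_mem_left _ k hab)
  exact (sub_eq_zero.mp (h1.mul_right_eq_zero.mp hk.symm)).symm

theorem mem_valuationSubring_iff_norm {L : Type*} [NormedField L] [IsUltrametricDist L] {x : L} :
    x ∈ (NormedField.valuation (K := L)).valuationSubring ↔ ‖x‖ ≤ 1 := by
  rw [Valuation.mem_valuationSubring_iff, NormedField.valuation_apply, ← NNReal.coe_le_coe]
  simp

theorem mem_maximalIdeal_iff_norm {L : Type*} [NormedField L] [IsUltrametricDist L]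
    {x : (NormedField.valuation (K := L)).valuationSubring} :
    x ∈ maximalIdeal (NormedField.valuation (K := L)).valuationSubring ↔ ‖(x : L)‖ < 1 := by
  rw [Valuation.mem_maximalIdeal_iff, NormedField.valuation_apply, ← NNReal.coe_lt_coe]
  simp

/-- A field homomorphism that preserves the norm restricts to the valuation rings. -/
noncomputable def valuationSubringMap {L Ω : Type*} [NormedField L] [IsUltrametricDist L]
    [NormedField Ω] [IsUltrametricDist Ω] (φ : L →+* Ω) (hφ : ∀ x, ‖φ x‖ = ‖x‖) :
    (NormedField.valuation (K := L)).valuationSubring →+*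
      (NormedField.valuation (K := Ω)).valuationSubring :=
  (φ.comp (NormedField.valuation (K := L)).valuationSubring.subtype).codRestrict _ fun x =>
    mem_valuationSubring_iff_norm.mpr ((hφ _).trans_le (mem_valuationSubring_iff_norm.mp x.2))

theorem valuationSubringMap_mem_maximalIdeal {L Ω : Type*} [NormedField L] [IsUltrametricDist L]
    [NormedField Ω] [IsUltrametricDist Ω] {φ : L →+* Ω} {hφ : ∀ x, ‖φ x‖ = ‖x‖}
    {x : (NormedField.valuation (K := L)).valuationSubring} (hx : x ∈ maximalIdeal _) :
    valuationSubringMap φ hφ x ∈ maximalIdeal _ :=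
  mem_maximalIdeal_iff_norm.mpr ((hφ _).trans_lt (mem_maximalIdeal_iff_norm.mp hx))

/-- If the norm of `L` extends to a Galois-invariant norm of an algebraically closed Galois
extension, then the valuation ring of `L` is henselian: the root close to a given simple residual
root is unique, hence fixed by the Galois group. -/
theorem henselianLocalRing_of_invariant_norm {L Ω : Type*} [NormedField L] [IsUltrametricDist L]
    [NormedField Ω] [IsUltrametricDist Ω] [Algebra L Ω] [IsAlgClosed Ω] [IsGalois L Ω]
    (hnorm : ∀ x : L, ‖algebraMap L Ω x‖ = ‖x‖) (hσ : ∀ (σ : Ω ≃ₐ[L] Ω) x, ‖σ x‖ = ‖x‖) :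
    HenselianLocalRing (NormedField.valuation (K := L)).valuationSubring where
  is_henselian f hf a₀ ha₀ hunit := by
    let φ := valuationSubringMap (algebraMap L Ω) hnorm
    let 𝒪 := (NormedField.valuation (K := Ω)).valuationSubring
    let F := f.map φ
    have hF : F.Monic := hf.map φ
    have hFa₀ : F.eval (φ a₀) ∈ maximalIdeal 𝒪 := by
      rw [eval_map, eval₂_at_apply]
      exact valuationSubringMap_mem_maximalIdeal ha₀
    have hFunit : IsUnit (F.derivative.eval (φ a₀)) := by
      rw [derivative_map, eval_map, eval₂_at_apply]
      exact hunit.map φ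
    obtain ⟨α, hα, hαa⟩ : ∃ α : 𝒪, F.IsRoot α ∧ α - φ a₀ ∈ maximalIdeal 𝒪 := by
      -- The product of the distances from `a₀` to the roots is `‖F(a₀)‖ < 1`.
      have hprod := (IsAlgClosed.splits (F.map 𝒪.subtype)).eval_eq_prod_roots_of_monic
        (hF.map _) (φ a₀ : Ω)
      have hlt : ‖(F.map 𝒪.subtype).eval (φ a₀ : Ω)‖ < 1 := by
        have : (F.map 𝒪.subtype).eval (φ a₀ : Ω) = (F.eval (φ a₀) : 𝒪) := by
          rw [eval_map]; exact eval₂_at_apply 𝒪.subtype (φ a₀)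
        rw [this]
        exact mem_maximalIdeal_iff_norm.mp hFa₀
      obtain ⟨β, hβ, hβ1⟩ : ∃ β ∈ (F.map 𝒪.subtype).roots, ‖(φ a₀ : Ω) - β‖ < 1 := by
        by_contra! hcon
        refine hlt.not_ge ?_
        rw [hprod, ← normHom_apply, map_multiset_prod, Multiset.map_map]
        exact Multiset.one_le_prod fun x hx => by
          obtain ⟨β, hβ, rfl⟩ := Multiset.mem_map.mp hx
          exact hcon β hβ
      have hβ𝒪 : β ∈ 𝒪 := by
        have h1 : (φ a₀ : Ω) - β ∈ 𝒪 := mem_valuationSubring_iff_norm.mpr hβ1.le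
        have := sub_mem (φ a₀).2 h1
        rwa [sub_sub_cancel] at this
      refine ⟨⟨β, hβ𝒪⟩, ?_, ?_⟩
      · have h1 := (mem_roots'.mp hβ).2
        apply Subtype.val_injective
        rw [IsRoot.def, eval_map] at h1
        exact (eval₂_at_apply 𝒪.subtype (⟨β, hβ𝒪⟩ : 𝒪)).symm.trans h1
      · rw [mem_maximalIdeal_iff_norm, ← norm_neg]
        simpa using hβ1
    have hfix : ∀ σ : Ω ≃ₐ[L] Ω, σ (α : Ω) = α := by
      intro σ
      let τ := valuationSubringMap (σ : Ω →+* Ω) (hσ σ)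
      have hτφ : ∀ x, τ (φ x) = φ x := fun x => Subtype.ext (σ.commutes _)
      have hτF : F.map τ = F := by
        rw [Polynomial.map_map]
        congr 1
        exact RingHom.ext hτφ
      have h1 : F.IsRoot (τ α) := by
        rw [← hτF]; exact hα.map
      have h2 : τ α - φ a₀ ∈ maximalIdeal 𝒪 := by
        rw [← hτφ, ← map_sub]
        exact valuationSubringMap_mem_maximalIdeal hαa
      exact congrArg Subtype.val (root_unique_of_isUnit_derivative hFunit h1 hα h2 hαa)
    obtain ⟨a, ha⟩ := (InfiniteGalois.mem_range_algebraMap_iff_fixed (k := L) (α : Ω)).mpr hfix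
    have haO : a ∈ (NormedField.valuation (K := L)).valuationSubring := by
      rw [mem_valuationSubring_iff_norm, ← hnorm, ha]
      exact mem_valuationSubring_iff_norm.mp α.2
    have hφa : φ ⟨a, haO⟩ = α := Subtype.ext ha
    have hφinj : Function.Injective φ := fun x y h =>
      Subtype.ext ((algebraMap L Ω).injective (congrArg Subtype.val h))
    refine ⟨⟨a, haO⟩, ?_, ?_⟩
    · apply hφinj
      rw [map_zero, ← eval₂_at_apply, ← eval_map, hφa]
      exact hα
    · rw [mem_maximalIdeal_iff_norm, ← hnorm]
      rw [← hφa, ← map_sub] at hαa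
      exact mem_maximalIdeal_iff_norm.mp hαa

/-- The valuation ring of an algebraic extension of a complete nonarchimedean field of
characteristic zero is henselian: the spectral norm on the algebraic closure extends the given
norm and is invariant. -/
theorem henselianLocalRing_of_isAlgebraic (K₀ L : Type*) [NontriviallyNormedField K₀]
    [IsUltrametricDist K₀] [CompleteSpace K₀] [CharZero K₀] [NormedField L] [IsUltrametricDist L]
    [NormedAlgebra K₀ L] [Algebra.IsAlgebraic K₀ L] :
    HenselianLocalRing (NormedField.valuation (K := L)).valuationSubring := by
  have : CharZero L := charZero_of_injective_algebraMap (algebraMap K₀ L).injective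
  let Ω := AlgebraicClosure L
  have : Algebra.IsAlgebraic K₀ Ω := Algebra.IsAlgebraic.trans K₀ L Ω
  let _ : NormedField Ω := spectralNorm.normedField K₀ Ω
  have : IsUltrametricDist Ω :=
    IsUltrametricDist.isUltrametricDist_of_isNonarchimedean_norm isNonarchimedean_spectralNorm
  refine henselianLocalRing_of_invariant_norm (L := L) (Ω := Ω) (fun x => ?_) fun σ x => ?_
  · rw [NormedAlgebra.norm_eq_spectralNorm K₀ x]
    exact (spectralNorm.eq_of_tower (K := K₀) (L := Ω) x).symm
  · exact (spectralNorm_eq_of_equiv (σ.restrictScalars K₀) x).symm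

end Henselian

/-! ### Lifting from the residue field -/

section Lifting

open Polynomial IsLocalRing

variable {ι : Type*} [Fintype ι] [DecidableEq ι]

/-- At a simple root `α` of the characteristic polynomial of `a`, written `(X - α) q`, the matrix
`q(a)` is nonzero of rank one: its columns lie in the one-dimensional eigenspace of `α`. -/
theorem exists_aeval_eq_vecMulVec {L : Type*} [Field L] {a : Matrix ι ι L} {α : L}
    (hα : a.charpoly.IsRoot α) (hα' : a.charpoly.derivative.eval α ≠ 0) :
    ∃ v w : ι → L, v ≠ 0 ∧ w ≠ 0 ∧
      aeval a (a.charpoly /ₘ (X - C α)) = vecMulVec v w := by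
  set q := a.charpoly /ₘ (X - C α) with hq
  have hfac : (X - C α) * q = a.charpoly := mul_divByMonic_eq_iff_isRoot.mpr hα
  have hqα : q.eval α ≠ 0 := by
    intro h
    apply hα'
    rw [← hfac]
    simp [h]
  obtain ⟨v, hv, hva⟩ : ∃ v, v ≠ 0 ∧ a *ᵥ v = α • v := by
    have h1 : (scalar ι α - a).det = 0 := by
      rw [← eval_charpoly]; exact hα
    obtain ⟨v, hv, hv0⟩ := exists_mulVec_eq_zero_iff.mpr h1
    refine ⟨v, hv, ?_⟩
    rw [sub_mulVec, sub_eq_zero] at hv0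
    rw [← hv0]
    ext i
    simp [scalar_apply, mulVec_diagonal]
  have hqv : aeval a q *ᵥ v = q.eval α • v := by
    have h1 := Module.End.aeval_apply_of_hasEigenvector (f := toLin' a) (p := q) (μ := α) (x := v)
      ⟨Module.End.mem_eigenspace_iff.mpr (by simpa using hva), hv⟩
    rw [← h1, ← toLin'_apply]
    exact congrArg (fun f : Module.End L (ι → L) => f v)
      (aeval_algHom_apply (toLinAlgEquiv' : Matrix ι ι L ≃ₐ[L] _) a q).symm
  have hline : ∀ x, a *ᵥ x = α • x → ∃ c : L, c • v = x := by
    intro x hx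
    have h1 := LinearMap.finrank_eigenspace_le (toLin' a) α
    have h2 : a.charpoly.rootMultiplicity α ≤ 1 := by
      by_contra! h
      exact hα' ((one_lt_rootMultiplicity_iff_isRoot a.charpoly_monic.ne_zero).mp h).2
    rw [charpoly_toLin'] at h1
    have h3 := (finrank_le_one_iff (K := L) (V := Module.End.eigenspace (toLin' a) α)).mp
      (h1.trans h2)
    obtain ⟨y, hy⟩ := h3
    obtain ⟨c, hc⟩ := hy ⟨v, Module.End.mem_eigenspace_iff.mpr (by simpa using hva)⟩
    obtain ⟨d, hd⟩ := hy ⟨x, Module.End.mem_eigenspace_iff.mpr (by simpa using hx)⟩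
    have hc' : c • (y : ι → L) = v := congrArg Subtype.val hc
    have hd' : d • (y : ι → L) = x := congrArg Subtype.val hd
    have hc0 : c ≠ 0 := by rintro rfl; exact hv (by rw [← hc', zero_smul])
    exact ⟨d * c⁻¹, by rw [← hc', smul_smul, inv_mul_cancel_right₀ hc0, hd']⟩
  have hcol : ∀ j, ∃ c : L, c • v = fun i => aeval a q i j := by
    intro j
    apply hline
    have h1 : a * aeval a q = α • aeval a q := by
      have h2 : aeval a ((X - C α) * q) = 0 := by rw [hfac]; exact aeval_self_charpoly a
      rw [map_mul, map_sub, aeval_X, aeval_C, sub_mul, sub_eq_zero] at h2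
      rw [h2, Algebra.algebraMap_eq_smul_one, smul_mul_assoc, one_mul]
    ext i
    exact congrFun (congrFun h1 i) j
  choose c hc using hcol
  have hvc : aeval a q = vecMulVec v c := by
    ext i j
    rw [vecMulVec_apply, mul_comm]
    exact (congrFun (hc j) i).symm
  refine ⟨v, c, hv, ?_, hvc⟩
  rintro rfl
  rw [hvc] at hqv
  refine smul_ne_zero hqα hv ?_
  rw [← hqv]
  ext i
  simp [mulVec, vecMulVec]

/-- If `γ(a) = N a N⁻¹`, then `γ(q(a)) = N (^γ q)(a) N⁻¹` for every polynomial `q`. -/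
theorem aeval_map_eq_conj {L : Type*} [Field L] {γ : L →+* L} {a : Matrix ι ι L} {N : GL ι L}
    (ha : a.map γ = N.val * a * N⁻¹.val) (q : L[X]) :
    (aeval a q).map γ = N.val * aeval a (q.map γ) * N⁻¹.val := by
  induction q using Polynomial.induction_on' with
  | add p q hp hq =>
    rw [map_add, Matrix.map_add _ (_root_.map_add γ), hp, hq, Polynomial.map_add, map_add, mul_add,
      add_mul]
  | monomial n c =>
    have hpow : (a ^ n).map γ = N.val * a ^ n * N⁻¹.val := by
      rw [← Units.conj_pow, ← ha]
      exact map_pow γ.mapMatrix a n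
    rw [map_monomial, aeval_monomial, aeval_monomial, ← Algebra.smul_def, ← Algebra.smul_def,
      mul_smul_comm, smul_mul_assoc, ← hpow]
    ext i j
    exact map_mul γ _ _

/-- A matrix over a henselian valuation ring whose reduction is an idempotent of rank one has a
simple eigenvalue congruent to `1`, and the corresponding polynomial in it is a matrix of rank one
over the field of fractions. Automorphisms that conjugate the given matrix fix that eigenvalue, by
its uniqueness, so they conjugate the rank-one matrix too. -/
theorem exists_vecMulVec_of_residue {L : Type*} [Field L] {𝒪 : ValuationSubring L}
    [HenselianLocalRing 𝒪] [Nonempty ι] {e : Matrix ι ι 𝒪} {v₀ w₀ : ι → ResidueField 𝒪}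
    (he : e.map (residue 𝒪) = vecMulVec v₀ w₀) (h1 : w₀ ⬝ᵥ v₀ = 1) :
    ∃ v w : ι → L, v ≠ 0 ∧ w ≠ 0 ∧ ∀ (γ : L →+* L) (γ' : 𝒪 →+* 𝒪) (N : GL ι L),
      (∀ x, (γ' x : L) = γ x) → (∀ x ∈ maximalIdeal 𝒪, γ' x ∈ maximalIdeal 𝒪) →
      e.map (γ.comp 𝒪.subtype) = N.val * e.map 𝒪.subtype * N⁻¹.val →
      (vecMulVec v w).map γ = N.val * vecMulVec v w * N⁻¹.val := by
  set f := e.charpoly with hf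
  -- The reduction `X ^ n - X ^ (n - 1)` has `1` as a simple root.
  have hres : f.map (residue 𝒪) = X ^ Fintype.card ι - X ^ (Fintype.card ι - 1) := by
    rw [hf, ← charpoly_map, he, charpoly_vecMulVec, dotProduct_comm, h1, one_smul]
  have hf1 : f.eval 1 ∈ maximalIdeal 𝒪 := by
    rw [← residue_eq_zero_iff, ← eval₂_at_apply, map_one, ← eval_map, hres]
    simp
  have hf1' : IsUnit (f.derivative.eval 1) := by
    rw [← residue_ne_zero_iff_isUnit, ← eval₂_at_apply, map_one, ← eval_map, ← derivative_map, hres]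
    obtain ⟨n, hn⟩ := Nat.exists_eq_succ_of_ne_zero (Fintype.card_ne_zero (α := ι))
    simp [hn, derivative_X_pow]
  obtain ⟨α, hα, hα1⟩ := HenselianLocalRing.is_henselian f e.charpoly_monic 1 hf1 hf1'
  set a := e.map 𝒪.subtype with ha
  have hfa : a.charpoly = f.map 𝒪.subtype := charpoly_map e 𝒪.subtype
  have hroot : a.charpoly.IsRoot (α : L) := by
    rw [hfa]; exact hα.map
  have hroot' : a.charpoly.derivative.eval (α : L) ≠ 0 := by
    rw [hfa, derivative_map, eval_map]
    change eval₂ 𝒪.subtype (𝒪.subtype α) _ ≠ 0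
    rw [eval₂_at_apply]
    exact ((isUnit_eval_of_sub_mem hf1' hα1).map 𝒪.subtype).ne_zero
  obtain ⟨v, w, hv, hw, hvw⟩ := exists_aeval_eq_vecMulVec hroot hroot'
  refine ⟨v, w, hv, hw, fun γ γ' N hγ hγ' hN => ?_⟩
  have haN : a.map γ = N.val * a * N⁻¹.val := by
    rw [← hN]; ext; rfl
  have hcharpoly : a.charpoly.map γ = a.charpoly := by
    rw [← charpoly_map, haN]
    rw [coe_units_inv]
    exact charpoly_units_conj N a
  have hfγ : f.map γ' = f := by
    apply Polynomial.map_injective 𝒪.subtype Subtype.val_injective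
    rw [← hfa, ← hcharpoly, hfa, Polynomial.map_map, Polynomial.map_map]
    congr 1
    exact RingHom.ext hγ
  have hαγ : γ α = α := by
    have h2 : f.IsRoot (γ' α) := by
      rw [← hfγ]; exact hα.map
    have h3 : γ' α - 1 ∈ maximalIdeal 𝒪 := by
      rw [← map_one γ', ← map_sub]
      exact hγ' _ hα1
    rw [← hγ, root_unique_of_isUnit_derivative hf1' h2 hα h3 hα1]
  rw [← hvw, aeval_map_eq_conj haN, map_divByMonic _ (monic_X_sub_C _), hcharpoly,
    Polynomial.map_sub, map_X, map_C, hαγ]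

/-- If the reductions of a set of matrices span the matrix algebra over the residue field, then
the matrices span the matrix algebra over the field of fractions. -/
theorem span_eq_top_of_residue {L : Type*} [Field L] {𝒪 : ValuationSubring L}
    {S : Set (Matrix ι ι 𝒪)}
    (hS : Submodule.span (ResidueField 𝒪) ((fun s => s.map (residue 𝒪)) '' S) = ⊤) :
    Submodule.span L ((fun s => s.map 𝒪.subtype) '' S) = ⊤ := by
  rw [span_eq_top_iff_trace] at hS ⊢
  intro c hc
  by_contra hc0
  -- Scale `c` by an entry of maximal valuation: it becomes integral with an entry equal to `1`.
  obtain ⟨p, q, hpq⟩ : ∃ p q, c p q ≠ 0 := by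
    by_contra! h
    exact hc0 (Matrix.ext h)
  have : Nonempty (ι × ι) := ⟨(p, q)⟩
  obtain ⟨⟨i, j⟩, hmax⟩ := Finite.exists_max fun x : ι × ι => 𝒪.valuation (c x.1 x.2)
  have hij : c i j ≠ 0 := by
    intro h
    have := hmax (p, q)
    rw [h, map_zero, le_zero_iff, map_eq_zero] at this
    exact hpq this
  let d : Matrix ι ι 𝒪 := Matrix.of fun k l => ⟨(c i j)⁻¹ * c k l, by
    rw [← ValuationSubring.valuation_le_one_iff, map_mul, map_inv₀]
    exact inv_mul_le_one_of_le₀ (hmax (k, l)) zero_le⟩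
  have hd : d.map 𝒪.subtype = (c i j)⁻¹ • c := by ext; rfl
  have hd0 := hS (d.map (residue 𝒪)) (by
    rintro _ ⟨s, hs, rfl⟩
    have h1 : trace (d * s) = 0 := by
      apply Subtype.val_injective
      change 𝒪.subtype (trace (d * s)) = 0
      rw [AddMonoidHom.map_trace, Matrix.map_mul, hd, smul_mul_assoc, trace_smul,
        hc _ ⟨s, hs, rfl⟩, smul_zero]
    rw [← Matrix.map_mul, ← AddMonoidHom.map_trace, h1, map_zero])
  have h2 := congrFun (congrFun hd0 i) j
  have h3 : d i j = 1 := Subtype.ext (inv_mul_cancel₀ hij)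
  rw [map_apply, h3, map_one] at h2
  exact one_ne_zero h2

end Lifting

/-! ### Residue fields of `ℓ`-adic fields -/

section Residue

open Polynomial IsLocalRing

/-- Elements of norm at most one are integral over `ℤ_ℓ`: the norm is the spectral norm, which
bounds the coefficients of the minimal polynomial. -/
theorem exists_monic_padicInt_of_norm_le_one (ℓ : ℕ) [Fact ℓ.Prime] {L : Type*} [NormedField L]
    [NormedAlgebra ℚ_[ℓ] L] [Algebra.IsAlgebraic ℚ_[ℓ] L] {x : L} (hx : ‖x‖ ≤ 1) :
    ∃ P : ℤ_[ℓ][X], P.Monic ∧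
      P.eval₂ ((algebraMap ℚ_[ℓ] L).comp PadicInt.Coe.ringHom) x = 0 := by
  have hint : IsIntegral ℚ_[ℓ] x := Algebra.IsIntegral.isIntegral x
  rw [NormedAlgebra.norm_eq_spectralNorm ℚ_[ℓ], spectralNorm,
    spectralValue_le_one_iff (minpoly.monic hint)] at hx
  have hlift : minpoly ℚ_[ℓ] x ∈ lifts (PadicInt.Coe.ringHom : ℤ_[ℓ] →+* ℚ_[ℓ]) :=
    (lifts_iff_coeff_lifts _).mpr fun n => ⟨⟨_, hx n⟩, rfl⟩
  obtain ⟨P, hP, -, hPm⟩ := lifts_and_natDegree_eq_and_monic hlift (minpoly.monic hint)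
  refine ⟨P, hPm, ?_⟩
  rw [← eval₂_map, hP]
  exact minpoly.aeval _ _

/-- The residue field of an algebraic extension of `ℚ_ℓ` is algebraic over the residue field of
`ℤ_ℓ`, which is finite. -/
theorem exists_isAlgebraic_residueField (ℓ : ℕ) [Fact ℓ.Prime] (L : Type*) [NormedField L]
    [IsUltrametricDist L] [NormedAlgebra ℚ_[ℓ] L] [Algebra.IsAlgebraic ℚ_[ℓ] L] :
    ∃ _ : Algebra (ResidueField ℤ_[ℓ])
      (ResidueField (NormedField.valuation (K := L)).valuationSubring),
      Algebra.IsAlgebraic (ResidueField ℤ_[ℓ])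
        (ResidueField (NormedField.valuation (K := L)).valuationSubring) := by
  let 𝒪 := (NormedField.valuation (K := L)).valuationSubring
  let φ : ℤ_[ℓ] →+* 𝒪 :=
    ((algebraMap ℚ_[ℓ] L).comp PadicInt.Coe.ringHom).codRestrict 𝒪 fun x =>
      mem_valuationSubring_iff_norm.mpr ((norm_algebraMap' L _).trans_le x.2)
  have hφnorm : ∀ x, ‖(φ x : L)‖ = ‖x‖ := fun x => norm_algebraMap' L (x : ℚ_[ℓ])
  have hφ : IsLocalHom φ := ⟨fun x hx => by
    refine PadicInt.isUnit_iff.mpr (le_antisymm (PadicInt.norm_le_one x) (not_lt.mp fun h => ?_))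
    exact (mem_maximalIdeal _).mp (mem_maximalIdeal_iff_norm.mpr ((hφnorm x).trans_lt h)) hx⟩
  let ψ := ResidueField.map φ
  refine ⟨ψ.toAlgebra, ?_⟩
  let _ := ψ.toAlgebra
  refine ⟨fun y => ?_⟩
  obtain ⟨x, rfl⟩ := residue_surjective y
  obtain ⟨P, hPm, hP⟩ := exists_monic_padicInt_of_norm_le_one ℓ
    (mem_valuationSubring_iff_norm.mp x.2)
  refine ⟨P.map (residue _), (hPm.map _).ne_zero, ?_⟩
  have h1 : P.eval₂ φ x = 0 := by
    apply Subtype.val_injective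
    change 𝒪.subtype _ = 0
    rw [hom_eval₂]
    exact hP
  rw [aeval_def, eval₂_map]
  have h2 := congrArg (residue 𝒪) h1
  rw [hom_eval₂, map_zero] at h2
  exact h2

end Residue

/-! ### The two cases of the theorem -/

section Conclusion

variable {ι : Type} [Fintype ι] [DecidableEq ι] {𝒢 : MatrixGroup.{u} ι}
  {G : Type w} [Group G] [TopologicalSpace G]

/-- The case of finite fields: the idempotent of rank one lies in the ring generated by the
representation itself. -/
theorem isLeast_twistField_of_finite {L : Type u} [Field L] [TopologicalSpace L]
    [DiscreteTopology L] {K : Type v} [Field K] [Finite K] [Algebra K L] [IsGalois K L]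
    (h𝒢 : 𝒢.HasDescent) (ρ : G →ₜ* 𝒢.pts L)
    (hρ : IsAbsolutelyIrreducible (restrictTwistKernel 𝒢 ρ K)) :
    IsLeast {F : IntermediateField K L | ProjDefinedOver 𝒢 ρ F} (twistField 𝒢 ρ K) := by
  have : Nonempty ι := hρ.nonempty
  have : ContinuousInv₀ L := ⟨fun _ _ => continuous_of_discreteTopology.continuousAt⟩
  obtain ⟨v, w, hmem, hwv⟩ := exists_vecMulVec_mem_closure K hρ.span_eq_top
  refine ⟨projDefinedOver_twistField h𝒢 ρ hρ.span_eq_top (v := v) (w := w) ?_ ?_ ?_, fun F hF =>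
    twistField_le_of_projDefinedOver (fun γ => continuous_of_discreteTopology) hF⟩
  · rintro rfl; simp at hwv
  · rintro rfl; simp at hwv
  · intro γ hγ h
    obtain ⟨M, -, hM⟩ := exists_conj_of_mem_twistGalois hγ
    refine map_coeff_eq_of_map_vecMulVec (φ := (γ : L →+* L)) (N := M.val)
      (congrArg Units.val (hM h)) ?_
    have h1 := map_eq_conj_of_mem_closure (φ := (γ : L →+* L)) (ψ := RingHom.id L) (N := M.val) (by
      rintro _ ⟨h, rfl⟩
      exact congrArg Units.val (hM h)) hmem
    exact h1

/-- The case of `ℓ`-adic fields: the idempotent of rank one lies in the ring generated by the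
reduction of an integral model, and is lifted by Hensel's lemma. -/
theorem isLeast_twistField_of_padic (ℓ : ℕ) [Fact ℓ.Prime] {L : Type u} {K : Type v}
    [Field K] [Algebra ℚ_[ℓ] K] [FiniteDimensional ℚ_[ℓ] K]
    [NormedField L] [IsUltrametricDist L] [NormedAlgebra ℚ_[ℓ] L]
    [Algebra K L] [IsScalarTower ℚ_[ℓ] K L] [IsGalois K L]
    (h𝒢 : 𝒢.HasDescent) (ρ : G →ₜ* 𝒢.pts L)
    (hρ : IsResiduallyAbsolutelyIrreducible (NormedField.valuation (K := L)).valuationSubring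
      (restrictTwistKernel 𝒢 ρ K)) :
    IsLeast {F : IntermediateField K L | ProjDefinedOver 𝒢 ρ F} (twistField 𝒢 ρ K) := by
  have : Algebra.IsAlgebraic ℚ_[ℓ] L := Algebra.IsAlgebraic.trans ℚ_[ℓ] K L
  have hnorm : ∀ (γ : L ≃ₐ[K] L) x, ‖γ x‖ = ‖x‖ := fun γ x => by
    rw [NormedAlgebra.norm_eq_spectralNorm ℚ_[ℓ] x, NormedAlgebra.norm_eq_spectralNorm ℚ_[ℓ] (γ x)]
    exact (spectralNorm_eq_of_equiv (γ.restrictScalars ℚ_[ℓ]) x).symm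
  have hcont : ∀ γ : L ≃ₐ[K] L, Continuous γ := fun γ =>
    (AddMonoidHomClass.isometry_of_norm γ (hnorm γ)).continuous
  have hhens := henselianLocalRing_of_isAlgebraic ℚ_[ℓ] L
  have hfin : Finite (IsLocalRing.ResidueField ℤ_[ℓ]) :=
    Finite.of_equiv _ (PadicInt.residueField (p := ℓ)).symm.toEquiv
  obtain ⟨halg₀, halg⟩ := exists_isAlgebraic_residueField ℓ L
  let 𝒪 := (NormedField.valuation (K := L)).valuationSubring
  obtain ⟨A, σ₀, hσ₀, hirr⟩ := hρ
  set σ := restrictTwistKernel 𝒢 ρ K with hσ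
  have : Nonempty ι := hirr.nonempty
  -- The integral matrices, whose reductions span the matrix algebra.
  let S : Set (Matrix ι ι 𝒪) := Set.range fun h => (σ₀ h).val
  have hSres : ((fun s : Matrix ι ι 𝒪 => s.map (IsLocalRing.residue 𝒪)) '' S)
      = Set.range fun h => (((GeneralLinearGroup.map (IsLocalRing.residue 𝒪)).comp σ₀) h).val := by
    rw [← Set.range_comp]; rfl
  have hspanres : Submodule.span (IsLocalRing.ResidueField 𝒪)
      ((fun s : Matrix ι ι 𝒪 => s.map (IsLocalRing.residue 𝒪)) '' S) = ⊤ := by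
    rw [hSres]; exact hirr.span_eq_top
  have hspan : Submodule.span L (Set.range fun h => (σ h : Matrix ι ι L)) = ⊤ := by
    have h1 := span_eq_top_of_residue hspanres
    rw [span_eq_top_iff_trace] at h1 ⊢
    intro c hc
    have h2 := h1 (A.val * c * A⁻¹.val) (by
      rintro _ ⟨_, ⟨h, rfl⟩, rfl⟩
      have h3 : (σ₀ h).val.map 𝒪.subtype = A.val * (σ h).val * A⁻¹.val :=
        congrArg Units.val (hσ₀ h)
      have h4 : A.val * c * A⁻¹.val * (A.val * (σ h).val * A⁻¹.val)
          = A.val * (c * (σ h).val) * A⁻¹.val := by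
        simp only [mul_assoc, Units.inv_mul_cancel_left]
      simp only [h3]
      rw [h4, trace_mul_cycle, Units.inv_mul, one_mul, hc _ ⟨h, rfl⟩])
    calc c = A⁻¹.val * (A.val * c * A⁻¹.val) * A.val := by
          simp [mul_assoc]
      _ = 0 := by rw [h2, mul_zero, zero_mul]
  obtain ⟨v₀, w₀, hmem, hwv⟩ :=
    exists_vecMulVec_mem_closure (IsLocalRing.ResidueField ℤ_[ℓ]) hspanres
  obtain ⟨e, heS, he⟩ : ∃ e ∈ Subring.closure S,
      e.map (IsLocalRing.residue 𝒪) = vecMulVec v₀ w₀ := by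
    have h1 : vecMulVec v₀ w₀ ∈ (Subring.closure S).map (IsLocalRing.residue 𝒪).mapMatrix := by
      rw [RingHom.map_closure]; exact hmem
    exact h1
  obtain ⟨v, w, hv, hw, hvw⟩ := exists_vecMulVec_of_residue he hwv
  have hcoeff : ∀ h, (w ᵥ* A.val) ⬝ᵥ (σ h).val *ᵥ (A⁻¹.val *ᵥ v)
      = w ⬝ᵥ (σ₀ h).val.map 𝒪.subtype *ᵥ v := by
    intro h
    have h3 : (σ₀ h).val.map 𝒪.subtype = A.val * (σ h).val * A⁻¹.val :=
      congrArg Units.val (hσ₀ h)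
    rw [h3, mulVec_mulVec, ← dotProduct_mulVec, mulVec_mulVec, mul_assoc]
  refine ⟨projDefinedOver_twistField h𝒢 ρ hspan (v := A⁻¹.val *ᵥ v) (w := w ᵥ* A.val) ?_ ?_ ?_,
    fun F hF => twistField_le_of_projDefinedOver hcont hF⟩
  · intro h0
    apply hv
    have := congrArg (A.val *ᵥ ·) h0
    simpa using this
  · intro h0
    apply hw
    have := congrArg (· ᵥ* A⁻¹.val) h0
    simpa using this
  · intro γ hγ h
    rw [hcoeff]
    obtain ⟨M, -, hM⟩ := exists_conj_of_mem_twistGalois hγ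
    -- The matrix that conjugates the integral model to its image under `γ`.
    let N := GeneralLinearGroup.map (γ : L →+* L) A * M * A⁻¹
    have hN : ∀ h, (σ₀ h).val.map ((γ : L →+* L).comp 𝒪.subtype)
        = N.val * (σ₀ h).val.map 𝒪.subtype * N⁻¹.val := by
      intro h
      have h1 : GeneralLinearGroup.map (γ : L →+* L) (GeneralLinearGroup.map 𝒪.subtype (σ₀ h))
          = N * GeneralLinearGroup.map 𝒪.subtype (σ₀ h) * N⁻¹ := by
        rw [hσ₀, map_mul, map_mul, hM, map_inv]
        simp only [N, hσ]
        group
      exact congrArg Units.val h1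
    refine map_coeff_eq_of_map_vecMulVec (φ := (γ : L →+* L)) (N := N) (hN h) ?_
    refine hvw (γ : L →+* L) (valuationSubringMap (γ : L →+* L) (hnorm γ)) N (fun x => rfl)
      (fun x hx => valuationSubringMap_mem_maximalIdeal hx) ?_
    refine map_eq_conj_of_mem_closure ?_ heS
    rintro _ ⟨h, rfl⟩
    exact hN h

end Conclusion

end InnerTwist

theorem mainTheorem1 :
    -- finite fields, with the discrete topology
    (∀ (K : Type*) (L : Type*) [Field K] [Finite K]
        [Field L] [TopologicalSpace L] [DiscreteTopology L] [Algebra K L] [IsGalois K L]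
        (G : Type*) [Group G] [TopologicalSpace G] [IsTopologicalGroup G] [CompactSpace G],
      (∀ (n : ℕ) (ρ : G →ₜ* (InnerTwist.linear n).pts L),
        InnerTwist.IsAbsolutelyIrreducible
          (InnerTwist.restrictTwistKernel (InnerTwist.linear n) ρ K) →
        IsLeast {F : IntermediateField K L |
            InnerTwist.ProjDefinedOver (InnerTwist.linear n) ρ F}
          (InnerTwist.twistField (InnerTwist.linear n) ρ K)) ∧
      (∀ (m : ℕ) (ρ : G →ₜ* (InnerTwist.symplectic m).pts L),
        InnerTwist.IsAbsolutelyIrreducible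
          (InnerTwist.restrictTwistKernel (InnerTwist.symplectic m) ρ K) →
        IsLeast {F : IntermediateField K L |
            InnerTwist.ProjDefinedOver (InnerTwist.symplectic m) ρ F}
          (InnerTwist.twistField (InnerTwist.symplectic m) ρ K))) ∧
    -- `ℓ`-adic fields; the norm on `L` is the one that extends the `ℓ`-adic absolute value
    (∀ (ℓ : ℕ) [Fact ℓ.Prime] (K : Type*) (L : Type*)
        [Field K] [Algebra ℚ_[ℓ] K] [FiniteDimensional ℚ_[ℓ] K]
        [NormedField L] [IsUltrametricDist L] [NormedAlgebra ℚ_[ℓ] L]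
        [Algebra K L] [IsScalarTower ℚ_[ℓ] K L] [IsGalois K L]
        (G : Type*) [Group G] [TopologicalSpace G] [IsTopologicalGroup G] [CompactSpace G],
      (∀ (n : ℕ) (ρ : G →ₜ* (InnerTwist.linear n).pts L),
        InnerTwist.IsResiduallyAbsolutelyIrreducible
          (NormedField.valuation (K := L)).valuationSubring
          (InnerTwist.restrictTwistKernel (InnerTwist.linear n) ρ K) →
        IsLeast {F : IntermediateField K L |
            InnerTwist.ProjDefinedOver (InnerTwist.linear n) ρ F}
          (InnerTwist.twistField (InnerTwist.linear n) ρ K)) ∧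
      (∀ (m : ℕ) (ρ : G →ₜ* (InnerTwist.symplectic m).pts L),
        InnerTwist.IsResiduallyAbsolutelyIrreducible
          (NormedField.valuation (K := L)).valuationSubring
          (InnerTwist.restrictTwistKernel (InnerTwist.symplectic m) ρ K) →
        IsLeast {F : IntermediateField K L |
            InnerTwist.ProjDefinedOver (InnerTwist.symplectic m) ρ F}
          (InnerTwist.twistField (InnerTwist.symplectic m) ρ K))) := by
  refine ⟨fun K L => ?_, fun ℓ _ K L => ?_⟩
  · intro _ _ _ _ _ _ _ G _ _ _ _
    exact ⟨fun n ρ hρ => InnerTwist.isLeast_twistField_of_finite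
        (InnerTwist.hasDescent_linear n) ρ hρ,
      fun m ρ hρ => InnerTwist.isLeast_twistField_of_finite
        (InnerTwist.hasDescent_symplectic m) ρ hρ⟩
  · intro _ _ _ _ _ _ _ _ _ G _ _ _ _
    exact ⟨fun n ρ hρ => InnerTwist.isLeast_twistField_of_padic ℓ
        (InnerTwist.hasDescent_linear n) ρ hρ,
      fun m ρ hρ => InnerTwist.isLeast_twistField_of_padic ℓ
        (InnerTwist.hasDescent_symplectic m) ρ hρ⟩
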